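/- **Setting.** Let a Lie group $G$ act smoothly on the left on a finite-dimensional smooth manifold $Q$ so that the quotient map $\pi:Q\to Q/G$ is a smooth principal bundle. For $\xi\in\mathfrak g$ let $\xi_Q(q)=\frac{d}{dt}\big|_{0}\exp(t\xi)q$, let $\mathcal V_q=\{\xi_Q(q):\xi\in\mathfrak g\}$, let $\tilde G=(Q\times G)/G$ for the action $g\cdot(q,w)=(gq,gwg^{-1})$, with quotient map $\rho:Q\times G\to\tilde G$ and projection $p:\tilde G\to Q/G$, $p(\rho(q,w))=\pi(q)$. For $q,q'$ in the same orbit let $\tau(q,q')\in G$ be the element with $\tau(q,q')q'=q$. *System.* Let $L_d:Q\times Q\to\mathbb R$ be smooth, $\mathcal D\subset TQ$ a smooth subbundle and $\mathcal D_d\subset Q\times Q$ a submanifold, where $L_d$ and $\mathcal D_d$ are invariant under the diagonal action of $G$ and $\mathcal D$ under the lifted action. A discrete curve $q_0,\dots,q_N$ in $Q$ is a *trajectory* if $(q_k,q_{k+1})\in\mathcal D_d$ for $0\le k<N$ and, for $S_d(q_\cdot)=\sum_{k=0}^{N-1}L_d(q_k,q_{k+1})$, $dS_d(q_\cdot)(\delta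 q_\cdot)=0$ for all $\delta q_k\in\mathcal D_{q_k}$ ($0\le k\le N$) with $\delta q_0=0$, $\delta q_N=0$. Put $\mathfrak g^{\mathcal D}_q=\{\xi\in\mathfrak g:\xi_Q(q)\in\mathcal D_q\}$ and $\hat{\mathcal D}_r=d\pi(q)(\mathcal D_q)$ for any $q\in\pi^{-1}(r)$. *Connection.* Suppose $\mathcal S=\mathcal V\cap\mathcal D$ is a smooth subbundle and $\mathcal W,\mathcal U,\mathcal H$ are $G$-invariant smooth subbundles of $TQ$ with $\mathcal D=\mathcal S\oplus\mathcal H$, $\mathcal V=\mathcal S\oplus\mathcal U$, $TQ=\mathcal W\oplus(\mathcal D+\mathcal V)$. Let $h_q:T_{\pi(q)}(Q/G)\to T_qQ$ be the horizontal lift of the principal connection with horizontal space $\mathcal W\oplus\mathcal H$. *Affine discrete connection.* Let $\gamma:Q\to G$ be smooth with $\gamma(gq)=g\gamma(q)g^{-1}$, and let $Hor\subset Q\times Q$ be a $G$-invariant submanifold containing $\Gamma=\{(q,\gamma(q)q)\}$ such that, for every $q$, $Hor^2(q)=\{q_1:(q,q_1)\in Hor\}$ is a submanifold of $Q$ with $T_{q_1}Q=\mathcal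 V_{q_1}\oplus T_{q_1}Hor^2(q)$ for all $q_1\in Gq\cap Hor^2(q)$. Let $U\subset Q\times Q$ be a $G$-invariant open neighbourhood of $\Gamma$ and $V\subset Q/G\times Q/G$ an open neighbourhood of the diagonal such that for all $(q_0,q_1)$ with $(\pi(q_0),\pi(q_1))\in V$ there is exactly one $g=:\mathcal A_d(q_0,q_1)\in G$ with $(q_0,g^{-1}q_1)\in Hor\cap U$, and $\mathcal A_d$ is smooth on this set of pairs. (If $\mathcal A_d$ is globally defined, $V=Q/G\times Q/G$.) For $(\pi(q_0),r_1)\in V$ let $h^d_{q_0}(r_1)$ be the unique $q_1\in\pi^{-1}(r_1)$ with $(q_0,q_1)\in Hor\cap U$, and put $\tilde F_1(q_0,w_0,r_1)=w_0\,h^d_{q_0}(r_1)$, $\Upsilon(q_0,q_1)=(\rho(q_0,\mathcal A_d(q_0,q_1)),\pi(q_1))$, $\check L_d(q_0,w_0,r_1)=L_d(q_0,\tilde F_1(q_0,w_0,r_1))$, and $\hat{\mathcal D}_d=\Upsilon(\{(q_0,q_1)\in\mathcal D_d:(\pi(q_0),\pi(q_1))\in V\})\subset\tilde G\times Q/G$.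 *Reduced equations.* For $v=\rho(q,w)$, $q'=\tilde F_1(q,w,r')$ and $r=p(v)$ the components of the reduced force are $$\hat F_d^-(v,r')(\delta r)=D_2\check L_d(q,w,r')\,D_1\mathcal A_d(q,q')(h_q(\delta r)),\qquad \hat F_d^+(v,r')(\delta r')=D_2\check L_d(q,w,r')\,D_2\mathcal A_d(q,q')(h_{q'}(\delta r')).$$ For $(v_0,r_1,v_1,r_2)$ with $p(v_1)=r_1$ choose $(q_0,w_0)$ with $v_0=\rho(q_0,w_0)$, let $q_1=\tilde F_1(q_0,w_0,r_1)$, and let $w_1$ be the element of $G$ with $v_1=\rho(q_1,w_1)$. The *intrinsic horizontal equation* at $(v_0,r_1,v_1,r_2)$ is $$D_1\check L_d(q_1,w_1,r_2)(h_{q_1}(\delta r_1))+D_3\check L_d(q_0,w_0,r_1)(\delta r_1)+\hat F_d^-(v_1,r_2)(\delta r_1)+\hat F_d^+(v_0,r_1)(\delta r_1)=0\quad\text{for all }\delta r_1\in\hat{\mathcal D}_{r_1},$$ and the *intrinsic vertical equation* is $$D_2\check L_d(q_0,w_0,r_1)(\xi w_0)-D_2\check L_d(q_1,w_1,r_2)(\xi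 w_1)=0\quad\text{for all }\xi\in\mathfrak g^{\mathcal D}_{q_1},$$ where $\xi w\in T_wG$ is the right translate of $\xi$ by $w$. None of these conditions depends on the chosen representatives. **Theorem.** Let $N\ge1$, $(\bar q_0,\bar q_1)\in\mathcal D_d$, and let $v_0,\dots,v_{N-1}\in\tilde G$ and $r_0,\dots,r_N\in Q/G$ satisfy $p(v_k)=r_k$ for $0\le k<N$, $\pi(\bar q_0)=r_0$, $\pi(\bar q_1)=r_1$ and $v_0=\rho(\bar q_0,\mathcal A_d(\bar q_0,\bar q_1))$. Suppose that $(v_k,r_{k+1})\in\hat{\mathcal D}_d$ for $0\le k<N$ and that the intrinsic horizontal and vertical equations hold at $(v_k,r_{k+1},v_{k+1},r_{k+2})$ for all $k\geq 0$ with $k+1<N$. Define $q_0=\bar q_0$ and, for $0\le k<N$, writing $v_k=\rho(\tilde q_k,\tilde w_k)$, $$u_k=\tau(q_k,\tilde q_k)\,\tilde w_k\,\tau(q_k,\tilde q_k)^{-1},\qquad q_{k+1}=\tilde F_1(q_k,u_k,r_{k+1}).$$ Then $q_0,\dots,q_N$ is a trajectory of $(Q,L_d,\mathcal D,\mathcal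 D_d)$; $\pi(q_k)=r_k$ for $0\le k\le N$; for $0\le k<N$ one has $(r_k,r_{k+1})\in V$ and $\Upsilon(q_k,q_{k+1})=(v_k,r_{k+1})$; and $q_0=\bar q_0$, $q_1=\bar q_1$. -/

import Mathlib

open Set Filter Topology
open scoped Manifold ContDiff

noncomputable section

namespace DiscreteReduction

/-! ### General differential geometry -/

section Manifolds

variable {E H M : Type*} [NormedAddCommGroup E] [NormedSpace ℝ E] [TopologicalSpace H]
  [TopologicalSpace M] [ChartedSpace H M]

/-- The velocity at time `0` of a curve in a manifold, as an element of the tangent bundle. -/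
def velocity (I : ModelWithCorners ℝ E H) (c : ℝ → M) : TangentBundle I M :=
  ⟨c 0, mfderiv 𝓘(ℝ, ℝ) I c 0 (1 : ℝ)⟩

/-- `S` is an (embedded, smooth) submanifold of `M`: around each of its points there is a chart of
the smooth structure of `M` in which `S` is a linear subspace (a slice chart). -/
def IsSubmanifold (I : ModelWithCorners ℝ E H) (S : Set M) : Prop :=
  ∀ p ∈ S, ∃ e ∈ IsManifold.maximalAtlas I ∞ M, p ∈ e.source ∧
    ∃ F : Submodule ℝ E, (e.extend I) '' (e.source ∩ S) = (e.extend I).target ∩ (F : Set E)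

/-- The tangent space at `p` of a submanifold `S` of `M`, as a subspace of `T_p M`: it is spanned
by the velocities at `p` of the curves of `M` that run inside `S`. -/
def tangentSpaceOf (I : ModelWithCorners ℝ E H) (S : Set M) (p : M) :
    Submodule ℝ (TangentSpace I p) :=
  Submodule.span ℝ {v | ∃ c : ℝ → M, MDifferentiableAt 𝓘(ℝ, ℝ) I c 0 ∧
    (∀ᶠ t in 𝓝 (0 : ℝ), c t ∈ S) ∧ velocity I c = ⟨p, v⟩}

/-- A family of subspaces of the tangent spaces is a smooth subbundle of `TM`: it has smooth local
frames. -/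
def IsSubbundle (I : ModelWithCorners ℝ E H) [IsManifold I ∞ M]
    (D : ∀ p : M, Submodule ℝ (TangentSpace I p)) : Prop :=
  ∀ p₀ : M, ∃ O : Set M, IsOpen O ∧ p₀ ∈ O ∧
    ∃ (m : ℕ) (X : Fin m → ∀ p : M, TangentSpace I p),
      (∀ i, ContMDiffOn I I.tangent ∞ (fun p ↦ (⟨p, X i p⟩ : TangentBundle I M)) O) ∧
      ∀ p ∈ O, LinearIndependent ℝ (fun i ↦ X i p) ∧
        Submodule.span ℝ (Set.range fun i ↦ X i p) = D p

end Manifolds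

/-! ### Orbit spaces and principal bundles -/

section Bundles

/-- The orbit space `Q/G`, with its quotient topology. -/
abbrev OrbitSpace (G Q : Type*) [Group G] [MulAction G Q] : Type _ :=
  Quotient (MulAction.orbitRel G Q)

/-- The quotient map `π : Q → Q/G`. -/
def proj (G : Type*) {Q : Type*} [Group G] [MulAction G Q] (q : Q) : OrbitSpace G Q :=
  Quotient.mk (MulAction.orbitRel G Q) q

/-- The action of `G` on `Q × G` by `g • (q, w) = (g • q, g w g⁻¹)`, as an orbit relation. -/
def conjSetoid (G Q : Type*) [Group G] [MulAction G Q] : Setoid (Q × G) where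
  r x y := ∃ g : G, g • x.1 = y.1 ∧ g * x.2 * g⁻¹ = y.2
  iseqv :=
    { refl := fun x ↦ ⟨1, by simp⟩
      symm := by
        rintro x y ⟨g, h₁, h₂⟩
        refine ⟨g⁻¹, ?_, ?_⟩
        · rw [← h₁, inv_smul_smul]
        · rw [← h₂]; group
      trans := by
        rintro x y z ⟨g, h₁, h₂⟩ ⟨k, h₃, h₄⟩
        refine ⟨k * g, ?_, ?_⟩
        · rw [← h₃, ← h₁, mul_smul]
        · rw [← h₄, ← h₂]; group }

/-- The conjugate associated bundle `G̃ = (Q × G)/G`. -/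
abbrev ConjBundle (G Q : Type*) [Group G] [MulAction G Q] : Type _ :=
  Quotient (conjSetoid G Q)

/-- The quotient map `ρ : Q × G → G̃`. -/
def rho {G Q : Type*} [Group G] [MulAction G Q] (q : Q) (w : G) : ConjBundle G Q :=
  Quotient.mk (conjSetoid G Q) (q, w)

/-- The projection `p^{Q/G} : G̃ → Q/G`, `ρ(q, w) ↦ π(q)`. -/
def bundleProj {G Q : Type*} [Group G] [MulAction G Q] (v : ConjBundle G Q) : OrbitSpace G Q :=
  Quotient.lift (fun x : Q × G ↦ proj G x.1)
    (by
      rintro x y ⟨g, h₁, -⟩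
      exact (Quotient.sound (s := MulAction.orbitRel G Q) ⟨g, h₁⟩ : proj G y.1 = proj G x.1).symm) v

/-- `τ(q, q')` is the element `g` of `G` with `g • q' = q` (for `q`, `q'` in the same orbit of a
free action). -/
def tau {G Q : Type*} [Group G] [MulAction G Q] (q q' : Q) : G :=
  Classical.epsilon fun g : G ↦ g • q' = q

/-- The coordinate in `G` of `v ∈ G̃` as seen from a point `q` over the same point of `Q/G`: if
`v = ρ(q', w')`, it is `τ(q, q') w' τ(q, q')⁻¹`, so that `v = ρ(q, fibreCoord q v)`. -/
def fibreCoord {G Q : Type*} [Group G] [MulAction G Q] (q : Q) (v : ConjBundle G Q) : G :=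
  tau q v.out.1 * v.out.2 * (tau q v.out.1)⁻¹

variable (EQ EG EB G Q : Type*)
  [NormedAddCommGroup EQ] [NormedSpace ℝ EQ] [NormedAddCommGroup EG] [NormedSpace ℝ EG]
  [NormedAddCommGroup EB] [NormedSpace ℝ EB]
  [Group G] [TopologicalSpace G] [ChartedSpace EG G]
  [TopologicalSpace Q] [ChartedSpace EQ Q] [MulAction G Q]
  [ChartedSpace EB (OrbitSpace G Q)]

/-- `π : Q → Q/G` is a smooth principal bundle with structure group `G`: the action is smooth and
`π` is locally trivial, through equivariant diffeomorphisms `π⁻¹(O) ≃ O × G`. -/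
structure IsPrincipalBundle : Prop where
  smooth_smul : ContMDiff (𝓘(ℝ, EG).prod 𝓘(ℝ, EQ)) 𝓘(ℝ, EQ) ∞ fun p : G × Q ↦ p.1 • p.2
  locally_trivial : ∀ b : OrbitSpace G Q, ∃ O : Set (OrbitSpace G Q), IsOpen O ∧ b ∈ O ∧
    ∃ Φ : PartialDiffeomorph 𝓘(ℝ, EQ) (𝓘(ℝ, EB).prod 𝓘(ℝ, EG)) Q (OrbitSpace G Q × G) ∞,
      Φ.source = proj G ⁻¹' O ∧ Φ.target = O ×ˢ univ ∧
      ∀ q ∈ Φ.source, (Φ q).1 = proj G q ∧ ∀ g : G, Φ (g • q) = (proj G q, g * (Φ q).2)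

variable {G Q}

/-- The infinitesimal generator `ξ_Q(q)` of the action, as a function of `ξ ∈ 𝔤`. -/
def infGen (q : Q) : GroupLieAlgebra 𝓘(ℝ, EG) G →L[ℝ] TangentSpace 𝓘(ℝ, EQ) q :=
  mfderiv 𝓘(ℝ, EG) 𝓘(ℝ, EQ) (fun g : G ↦ g • q) 1

/-- The vertical space `𝒱_q = {ξ_Q(q)}`, the tangent space at `q` of the orbit through `q`. -/
def vertical (q : Q) : Submodule ℝ (TangentSpace 𝓘(ℝ, EQ) q) :=
  (infGen EQ EG (G := G) q).toLinearMap.range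

/-- A family of subspaces of the tangent spaces of `Q` is invariant under the lifted action. -/
def IsInvariantFamily (G : Type*) [Group G] [MulAction G Q]
    (D : ∀ q : Q, Submodule ℝ (TangentSpace 𝓘(ℝ, EQ) q)) : Prop :=
  ∀ (g : G) (q : Q), ∀ v ∈ D q, mfderiv 𝓘(ℝ, EQ) 𝓘(ℝ, EQ) (fun x : Q ↦ g • x) q v ∈ D (g • q)

end Bundles

/-! ### Discrete mechanical systems -/

section Systems

variable (EQ EG G Q : Type*)
  [NormedAddCommGroup EQ] [NormedSpace ℝ EQ] [NormedAddCommGroup EG] [NormedSpace ℝ EG]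
  [Group G] [TopologicalSpace G] [ChartedSpace EG G]
  [TopologicalSpace Q] [ChartedSpace EQ Q] [IsManifold 𝓘(ℝ, EQ) ∞ Q] [MulAction G Q]

/-- A nonholonomic discrete mechanical system `(Q, L_d, 𝒟, 𝒟_d)`. -/
structure DiscreteSystem where
  /-- the discrete lagrangian `L_d` -/
  lagr : Q × Q → ℝ
  /-- the variational constraints `𝒟` -/
  distr : ∀ q : Q, Submodule ℝ (TangentSpace 𝓘(ℝ, EQ) q)
  /-- the discrete kinematic constraints `𝒟_d` -/
  kin : Set (Q × Q)
  smooth_lagr : ContMDiff (𝓘(ℝ, EQ).prod 𝓘(ℝ, EQ)) 𝓘(ℝ, ℝ) ∞ lagr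
  subbundle_distr : IsSubbundle 𝓘(ℝ, EQ) distr
  submanifold_kin : IsSubmanifold (𝓘(ℝ, EQ).prod 𝓘(ℝ, EQ)) kin

variable {EQ G Q}

/-- The discrete action `S_d(q) = ∑_{k < N} L_d(q_k, q_{k+1})`; only `q_0, …, q_N` matter. -/
def DiscreteSystem.action (Sys : DiscreteSystem EQ Q) (N : ℕ) (q : ℕ → Q) : ℝ :=
  ∑ k ∈ Finset.range N, Sys.lagr (q k, q (k + 1))

/-- The discrete curve `q_0, …, q_N` is a trajectory (discrete Lagrange–D'Alembert principle): it
satisfies the kinematic constraints, and `dS_d(q)(δq) = 0` for all infinitesimal variations `δq`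
with values in `𝒟` and vanishing end points. Here `dS_d(q)(δq)` is the derivative at `0` of `S_d`
along any family `t ↦ c_•(t)` of discrete curves whose velocity at `t = 0` is `δq`. -/
def DiscreteSystem.IsTrajectory (Sys : DiscreteSystem EQ Q) (N : ℕ) (q : ℕ → Q) : Prop :=
  (∀ k < N, (q k, q (k + 1)) ∈ Sys.kin) ∧
  ∀ δq : ∀ k, TangentSpace 𝓘(ℝ, EQ) (q k), (∀ k ≤ N, δq k ∈ Sys.distr (q k)) →
    δq 0 = 0 → δq N = 0 →
    ∀ c : ℕ → ℝ → Q,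
      (∀ k ≤ N, MDifferentiableAt 𝓘(ℝ, ℝ) 𝓘(ℝ, EQ) (c k) 0 ∧
        velocity 𝓘(ℝ, EQ) (c k) = ⟨q k, δq k⟩) →
      HasDerivAt (fun t ↦ Sys.action N fun k ↦ c k t) 0 0

/-- `G` is a symmetry group of the system (the bundle hypothesis being stated separately). -/
structure DiscreteSystem.IsSymmetric (Sys : DiscreteSystem EQ Q) (G : Type*) [Group G]
    [MulAction G Q] : Prop where
  lagr_smul : ∀ (g : G) (q₀ q₁ : Q), Sys.lagr (g • q₀, g • q₁) = Sys.lagr (q₀, q₁)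
  kin_smul : ∀ (g : G) (q₀ q₁ : Q), (q₀, q₁) ∈ Sys.kin → (g • q₀, g • q₁) ∈ Sys.kin
  distr_smul : IsInvariantFamily EQ G Sys.distr

/-- The fibre at `q` of `𝔤^𝒟 = {(q, ξ) : ξ_Q(q) ∈ 𝒟_q}`. -/
def DiscreteSystem.lieConstr (Sys : DiscreteSystem EQ Q) (EG : Type*) [NormedAddCommGroup EG]
    [NormedSpace ℝ EG] {G : Type*} [Group G] [TopologicalSpace G] [ChartedSpace EG G]
    [MulAction G Q] (q : Q) : Set (GroupLieAlgebra 𝓘(ℝ, EG) G) :=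
  {ξ | infGen EQ EG q ξ ∈ Sys.distr q}

/-- The fibre `𝒮_q = 𝒱_q ∩ 𝒟_q`. -/
def DiscreteSystem.vertDistr (Sys : DiscreteSystem EQ Q) (EG G : Type*) [NormedAddCommGroup EG]
    [NormedSpace ℝ EG] [Group G] [TopologicalSpace G] [ChartedSpace EG G]
    [MulAction G Q] (q : Q) : Submodule ℝ (TangentSpace 𝓘(ℝ, EQ) q) :=
  vertical EQ EG (G := G) q ⊓ Sys.distr q

/-- A decomposition `TQ = 𝒲 ⊕ 𝒰 ⊕ 𝒮 ⊕ ℋ` into `G`-invariant subbundles with `𝒟 = 𝒮 ⊕ ℋ` and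
`𝒱 = 𝒮 ⊕ 𝒰`, where `𝒮 = 𝒱 ∩ 𝒟`. -/
structure Splitting (EG G : Type*) [NormedAddCommGroup EG]
    [NormedSpace ℝ EG] [Group G] [TopologicalSpace G] [ChartedSpace EG G]
    [MulAction G Q] (Sys : DiscreteSystem EQ Q) where
  /-- the subbundle `ℋ` -/
  subH : ∀ q : Q, Submodule ℝ (TangentSpace 𝓘(ℝ, EQ) q)
  /-- the subbundle `𝒰` -/
  subU : ∀ q : Q, Submodule ℝ (TangentSpace 𝓘(ℝ, EQ) q)
  /-- the subbundle `𝒲` -/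
  subW : ∀ q : Q, Submodule ℝ (TangentSpace 𝓘(ℝ, EQ) q)
  subbundle_S : IsSubbundle 𝓘(ℝ, EQ) (Sys.vertDistr EG G)
  subbundle_H : IsSubbundle 𝓘(ℝ, EQ) subH
  subbundle_U : IsSubbundle 𝓘(ℝ, EQ) subU
  subbundle_W : IsSubbundle 𝓘(ℝ, EQ) subW
  invariant_H : IsInvariantFamily EQ G subH
  invariant_U : IsInvariantFamily EQ G subU
  invariant_W : IsInvariantFamily EQ G subW
  disjoint_S_H : ∀ q, Disjoint (Sys.vertDistr EG G q) (subH q)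
  sup_S_H : ∀ q, Sys.vertDistr EG G q ⊔ subH q = Sys.distr q
  disjoint_S_U : ∀ q, Disjoint (Sys.vertDistr EG G q) (subU q)
  sup_S_U : ∀ q, Sys.vertDistr EG G q ⊔ subU q = vertical EQ EG (G := G) q
  isCompl_W : ∀ q, IsCompl (subW q) (Sys.distr q ⊔ vertical EQ EG (G := G) q)

/-- The horizontal space `Hor_𝒜 = 𝒲 ⊕ ℋ` of the generalized nonholonomic connection `𝒜` associated
to the splitting. -/
def Splitting.horizontal {EG G : Type*} [NormedAddCommGroup EG]
    [NormedSpace ℝ EG] [Group G] [TopologicalSpace G] [ChartedSpace EG G]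
    [MulAction G Q] {Sys : DiscreteSystem EQ Q} (𝒮 : Splitting EG G Sys) (q : Q) :
    Submodule ℝ (TangentSpace 𝓘(ℝ, EQ) q) :=
  𝒮.subW q ⊔ 𝒮.subH q

end Systems

/-! ### Affine discrete connections -/

section Connections

variable (EQ EG G Q : Type*)
  [NormedAddCommGroup EQ] [NormedSpace ℝ EQ] [NormedAddCommGroup EG] [NormedSpace ℝ EG]
  [Group G] [TopologicalSpace G] [ChartedSpace EG G]
  [TopologicalSpace Q] [ChartedSpace EQ Q] [MulAction G Q]

/-- An affine discrete connection on `π : Q → Q/G`, of level `γ` and horizontal manifold `Hor`. -/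
structure AffineDiscreteConnection where
  /-- the level `γ : Q → G` -/
  level : Q → G
  /-- the horizontal submanifold `Hor ⊆ Q × Q` -/
  hor : Set (Q × Q)
  smooth_level : ContMDiff 𝓘(ℝ, EQ) 𝓘(ℝ, EG) ∞ level
  level_smul : ∀ (g : G) (q : Q), level (g • q) = g * level q * g⁻¹
  submanifold_hor : IsSubmanifold (𝓘(ℝ, EQ).prod 𝓘(ℝ, EQ)) hor
  hor_smul : ∀ (g : G) (q₀ q₁ : Q), (q₀, q₁) ∈ hor → (g • q₀, g • q₁) ∈ hor
  level_mem_hor : ∀ q : Q, (q, level q • q) ∈ hor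
  submanifold_slice : ∀ q : Q, IsSubmanifold 𝓘(ℝ, EQ) {q₁ | (q, q₁) ∈ hor}
  transversal : ∀ q q₁ : Q, q₁ ∈ MulAction.orbit G q → (q, q₁) ∈ hor →
    IsCompl (vertical EQ EG (G := G) q₁) (tangentSpaceOf 𝓘(ℝ, EQ) {x | (q, x) ∈ hor} q₁)

/-- An affine discrete connection together with a domain for its discrete connection form. `nbhd`
is a `G`-invariant open neighbourhood `U` of `Γ = {(q, γ(q) • q)}`, and `dom` is a neighbourhood of
the diagonal of `Q/G × Q/G` which says when `π(q₁)` is sufficiently close to `π(q₀)`; for such pairs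
there is exactly one `g ∈ G` with `(q₀, g⁻¹ • q₁) ∈ Hor ∩ U`, and this `g` depends smoothly on
`(q₀, q₁)`. The case of a globally defined form is `dom = univ`. -/
structure LocalDiscreteConnection extends AffineDiscreteConnection EQ EG G Q where
  /-- the `G`-invariant open neighbourhood `U` of `Γ` -/
  nbhd : Set (Q × Q)
  /-- the pairs of points of `Q/G` that are sufficiently close -/
  dom : Set (OrbitSpace G Q × OrbitSpace G Q)
  isOpen_nbhd : IsOpen nbhd
  nbhd_smul : ∀ (g : G) (q₀ q₁ : Q), (q₀, q₁) ∈ nbhd → (g • q₀, g • q₁) ∈ nbhd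
  level_mem_nbhd : ∀ q : Q, (q, level q • q) ∈ nbhd
  isOpen_dom : IsOpen dom
  diag_mem_dom : ∀ r : OrbitSpace G Q, (r, r) ∈ dom
  existsUnique : ∀ q₀ q₁ : Q, (proj G q₀, proj G q₁) ∈ dom →
    ∃! g : G, (q₀, g⁻¹ • q₁) ∈ hor ∩ nbhd
  smooth_form : ContMDiffOn (𝓘(ℝ, EQ).prod 𝓘(ℝ, EQ)) 𝓘(ℝ, EG) ∞
    (fun p : Q × Q ↦ Classical.epsilon fun g : G ↦ (p.1, g⁻¹ • p.2) ∈ hor ∩ nbhd)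
    {p | (proj G p.1, proj G p.2) ∈ dom}

variable {EQ EG G Q}

namespace LocalDiscreteConnection

variable (𝒜 : LocalDiscreteConnection EQ EG G Q)

/-- The discrete connection `1`-form `𝒜_d(q₀, q₁)`: the element `g` of `G` such that
`(q₀, q₁) = (q₀, g • q₀) · (q₀, g⁻¹ • q₁)` with `(q₀, g⁻¹ • q₁) ∈ Hor ∩ U`. -/
def form (q₀ q₁ : Q) : G :=
  Classical.epsilon fun g : G ↦ (q₀, g⁻¹ • q₁) ∈ 𝒜.hor ∩ 𝒜.nbhd

/-- The second component of the discrete horizontal lift of `r₁` at `q₀`: the point `q₁` over `r₁`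
with `(q₀, q₁) ∈ Hor` (inside `U`). -/
def horLift (q₀ : Q) (r₁ : OrbitSpace G Q) : Q :=
  @Classical.epsilon Q ⟨q₀⟩ fun q₁ ↦ (q₀, q₁) ∈ 𝒜.hor ∩ 𝒜.nbhd ∧ proj G q₁ = r₁

/-- `F̃₁(q₀, w₀, r₁) = w₀ • (horizontal lift of r₁ at q₀)`. -/
def recon (q₀ : Q) (w₀ : G) (r₁ : OrbitSpace G Q) : Q :=
  w₀ • 𝒜.horLift q₀ r₁

/-- `Υ(q₀, q₁) = (ρ(q₀, 𝒜_d(q₀, q₁)), π(q₁)) ∈ G̃ × Q/G`. -/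
def upsilon (p : Q × Q) : ConjBundle G Q × OrbitSpace G Q :=
  (rho p.1 (𝒜.form p.1 p.2), proj G p.2)

/-- The curve in `Q` reconstructed from `(v, r)` starting at `q̄₀`: if `v_k = ρ(q', w')`, then
`q_{k+1} = F̃₁(q_k, u_k, r_{k+1})` with `u_k = τ(q_k, q') w' τ(q_k, q')⁻¹`. -/
def reconstruct (v : ℕ → ConjBundle G Q) (r : ℕ → OrbitSpace G Q) (qbar : Q) : ℕ → Q
  | 0 => qbar
  | k + 1 =>
      𝒜.recon (reconstruct v r qbar k) (fibreCoord (reconstruct v r qbar k) (v k)) (r (k + 1))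

end LocalDiscreteConnection

end Connections

/-! ### Reduced objects and reduced equations of motion -/

section Reduced

variable {EQ EG G Q : Type*} (EB : Type*)
  [NormedAddCommGroup EQ] [NormedSpace ℝ EQ] [NormedAddCommGroup EG] [NormedSpace ℝ EG]
  [NormedAddCommGroup EB] [NormedSpace ℝ EB]
  [Group G] [TopologicalSpace G] [ChartedSpace EG G]
  [TopologicalSpace Q] [ChartedSpace EQ Q] [IsManifold 𝓘(ℝ, EQ) ∞ Q] [MulAction G Q]
  [ChartedSpace EB (OrbitSpace G Q)]

/-- The fibre at `r` of `𝒟̂ = dπ(𝒟) ⊆ T(Q/G)`. -/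
def redDistr (Sys : DiscreteSystem EQ Q) (r : OrbitSpace G Q) : Set (TangentSpace 𝓘(ℝ, EB) r) :=
  {δr | ∃ (q : Q) (v : TangentSpace 𝓘(ℝ, EQ) q), v ∈ Sys.distr q ∧
    tangentMap 𝓘(ℝ, EQ) 𝓘(ℝ, EB) (proj G) ⟨q, v⟩ = ⟨r, δr⟩}

/-- The reduced kinematic constraints `𝒟̂_d = Φ(𝒟_d/G) = Υ(𝒟_d) ⊆ G̃ × Q/G`, the image of the part
of `𝒟_d` in the domain of the discrete connection form. -/
def redKin (Sys : DiscreteSystem EQ Q) (𝒜 : LocalDiscreteConnection EQ EG G Q) :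
    Set (ConjBundle G Q × OrbitSpace G Q) :=
  𝒜.upsilon '' {p | p ∈ Sys.kin ∧ (proj G p.1, proj G p.2) ∈ 𝒜.dom}

/-- The horizontal lift at `q` of the connection `𝒜`: the vector `v ∈ Hor_𝒜(q)` such that
`dπ(q)(v) = δr ∈ T_r(Q/G)`, for `q` over `r`. -/
def Splitting.lift {Sys : DiscreteSystem EQ Q} (𝒮 : Splitting EG G Sys) (q : Q) {r : OrbitSpace G Q}
    (δr : TangentSpace 𝓘(ℝ, EB) r) : TangentSpace 𝓘(ℝ, EQ) q :=
  Classical.epsilon fun v ↦ v ∈ 𝒮.horizontal q ∧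
    tangentMap 𝓘(ℝ, EQ) 𝓘(ℝ, EB) (proj G) ⟨q, v⟩ = ⟨r, δr⟩

/-- The lagrangian `Ľ_d(q₀, w₀, r₁) = L_d(q₀, F̃₁(q₀, w₀, r₁))` on `Q × G × Q/G`. -/
def checkL (Sys : DiscreteSystem EQ Q) (𝒜 : LocalDiscreteConnection EQ EG G Q)
    (q₀ : Q) (w₀ : G) (r₁ : OrbitSpace G Q) : ℝ :=
  Sys.lagr (q₀, 𝒜.recon q₀ w₀ r₁)

/-- The partial differential `D₁Ľ_d(q₀, w₀, r₁)`. -/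
def D1checkL (Sys : DiscreteSystem EQ Q) (𝒜 : LocalDiscreteConnection EQ EG G Q)
    (q₀ : Q) (w₀ : G) (r₁ : OrbitSpace G Q) : TangentSpace 𝓘(ℝ, EQ) q₀ →L[ℝ] ℝ :=
  mfderiv 𝓘(ℝ, EQ) 𝓘(ℝ, ℝ) (fun q ↦ checkL Sys 𝒜 q w₀ r₁) q₀

/-- The partial differential `D₂Ľ_d(q₀, w₀, r₁)`. -/
def D2checkL (Sys : DiscreteSystem EQ Q) (𝒜 : LocalDiscreteConnection EQ EG G Q)
    (q₀ : Q) (w₀ : G) (r₁ : OrbitSpace G Q) : TangentSpace 𝓘(ℝ, EG) w₀ →L[ℝ] ℝ :=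
  mfderiv 𝓘(ℝ, EG) 𝓘(ℝ, ℝ) (fun w ↦ checkL Sys 𝒜 q₀ w r₁) w₀

/-- The partial differential `D₃Ľ_d(q₀, w₀, r₁)`. -/
def D3checkL (Sys : DiscreteSystem EQ Q) (𝒜 : LocalDiscreteConnection EQ EG G Q)
    (q₀ : Q) (w₀ : G) (r₁ : OrbitSpace G Q) : TangentSpace 𝓘(ℝ, EB) r₁ →L[ℝ] ℝ :=
  mfderiv 𝓘(ℝ, EB) 𝓘(ℝ, ℝ) (fun r ↦ checkL Sys 𝒜 q₀ w₀ r) r₁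

/-- The partial differential `D₁𝒜_d(q₀, q₁)`. -/
def D1form (𝒜 : LocalDiscreteConnection EQ EG G Q) (q₀ q₁ : Q) :
    TangentSpace 𝓘(ℝ, EQ) q₀ →L[ℝ] TangentSpace 𝓘(ℝ, EG) (𝒜.form q₀ q₁) :=
  mfderiv 𝓘(ℝ, EQ) 𝓘(ℝ, EG) (fun q ↦ 𝒜.form q q₁) q₀

/-- The partial differential `D₂𝒜_d(q₀, q₁)`. -/
def D2form (𝒜 : LocalDiscreteConnection EQ EG G Q) (q₀ q₁ : Q) :
    TangentSpace 𝓘(ℝ, EQ) q₁ →L[ℝ] TangentSpace 𝓘(ℝ, EG) (𝒜.form q₀ q₁) :=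
  mfderiv 𝓘(ℝ, EQ) 𝓘(ℝ, EG) (fun q ↦ 𝒜.form q₀ q) q₁

/-- The component `F̂_d⁻(v₀, r₁)(δr₀) = D₂Ľ_d(q₀, w₀, r₁) (D₁𝒜_d(q₀, q₁)(lift of δr₀ at q₀))` of the
reduced discrete force, where `v₀ = ρ(q₀, w₀)`, `q₁ = F̃₁(q₀, w₀, r₁)` and `δr₀ ∈ T_{r₀}(Q/G)` for
`r₀ = p^{Q/G}(v₀)`. Since `𝒜_d(q₀, q₁) = w₀`, the value of `D₁𝒜_d(q₀, q₁)` lies in `T_{w₀}G`. -/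
def forceMinus {Sys : DiscreteSystem EQ Q} (𝒮 : Splitting EG G Sys)
    (𝒜 : LocalDiscreteConnection EQ EG G Q) (v₀ : ConjBundle G Q) (r₁ : OrbitSpace G Q)
    {r₀ : OrbitSpace G Q} (δr₀ : TangentSpace 𝓘(ℝ, EB) r₀) : ℝ :=
  let q₀ := v₀.out.1
  let w₀ := v₀.out.2
  let q₁ := 𝒜.recon q₀ w₀ r₁
  D2checkL Sys 𝒜 q₀ w₀ r₁ (D1form 𝒜 q₀ q₁ (𝒮.lift EB q₀ δr₀))

/-- The component `F̂_d⁺(v₀, r₁)(δr₁) = D₂Ľ_d(q₀, w₀, r₁) (D₂𝒜_d(q₀, q₁)(lift of δr₁ at q₁))` of the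
reduced discrete force, where `v₀ = ρ(q₀, w₀)` and `q₁ = F̃₁(q₀, w₀, r₁)`. -/
def forcePlus {Sys : DiscreteSystem EQ Q} (𝒮 : Splitting EG G Sys)
    (𝒜 : LocalDiscreteConnection EQ EG G Q) (v₀ : ConjBundle G Q) (r₁ : OrbitSpace G Q)
    (δr₁ : TangentSpace 𝓘(ℝ, EB) r₁) : ℝ :=
  let q₀ := v₀.out.1
  let w₀ := v₀.out.2
  let q₁ := 𝒜.recon q₀ w₀ r₁
  D2checkL Sys 𝒜 q₀ w₀ r₁ (D2form 𝒜 q₀ q₁ (𝒮.lift EB q₁ δr₁))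

/-- The function `φ̌(q₀, w₀, r₁, v₁, r₂)` on `T_{r₁}(Q/G)`, for `p^{Q/G}(v₁) = r₁`; here
`q₁ = F̃₁(q₀, w₀, r₁)` and `w₁ = F₂(q₀, w₀, r₁, v₁, r₂)` is the coordinate of `v₁` seen
from `q₁`. -/
def checkPhi {Sys : DiscreteSystem EQ Q} (𝒮 : Splitting EG G Sys)
    (𝒜 : LocalDiscreteConnection EQ EG G Q) (q₀ : Q) (w₀ : G) (r₁ : OrbitSpace G Q)
    (v₁ : ConjBundle G Q) (r₂ : OrbitSpace G Q) (δr₁ : TangentSpace 𝓘(ℝ, EB) r₁) : ℝ :=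
  let q₁ := 𝒜.recon q₀ w₀ r₁
  let w₁ := fibreCoord q₁ v₁
  D1checkL Sys 𝒜 q₁ w₁ r₂ (𝒮.lift EB q₁ δr₁) + D3checkL EB Sys 𝒜 q₀ w₀ r₁ δr₁
    + forceMinus EB 𝒮 𝒜 v₁ r₂ δr₁ + forcePlus EB 𝒮 𝒜 (rho q₀ w₀) r₁ δr₁

/-- The morphism `φ̄ : p₂^*T(Q/G) → ℝ` over the second order reduced space, the value of `φ̌` at any
`(q₀, w₀)` with `ρ(q₀, w₀) = v₀`. -/
def barPhi {Sys : DiscreteSystem EQ Q} (𝒮 : Splitting EG G Sys)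
    (𝒜 : LocalDiscreteConnection EQ EG G Q) (v₀ : ConjBundle G Q) (r₁ : OrbitSpace G Q)
    (v₁ : ConjBundle G Q) (r₂ : OrbitSpace G Q) (δr₁ : TangentSpace 𝓘(ℝ, EB) r₁) : ℝ :=
  checkPhi EB 𝒮 𝒜 v₀.out.1 v₀.out.2 r₁ v₁ r₂ δr₁

/-- `D₂Ľ_d(q, w, r) w⁻¹ ∈ 𝔤^*`, that is, `ξ ↦ D₂Ľ_d(q, w, r)(ξ w)` where `ξ w ∈ T_w G` is the right
translate of `ξ ∈ 𝔤 = T_1 G` by `w`. -/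
def D2checkLRight (Sys : DiscreteSystem EQ Q) (𝒜 : LocalDiscreteConnection EQ EG G Q)
    (q : Q) (w : G) (r : OrbitSpace G Q) (ξ : GroupLieAlgebra 𝓘(ℝ, EG) G) : ℝ :=
  D2checkL Sys 𝒜 q w r (mfderiv 𝓘(ℝ, EG) 𝓘(ℝ, EG) (fun g : G ↦ g * w) 1 ξ)

/-- The function `ψ̌(q₀, w₀, r₁, v₁, r₂)` on `𝔤`. -/
def checkPsi (Sys : DiscreteSystem EQ Q) (𝒜 : LocalDiscreteConnection EQ EG G Q)
    (q₀ : Q) (w₀ : G) (r₁ : OrbitSpace G Q) (v₁ : ConjBundle G Q) (r₂ : OrbitSpace G Q)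
    (ξ₁ : GroupLieAlgebra 𝓘(ℝ, EG) G) : ℝ :=
  let q₁ := 𝒜.recon q₀ w₀ r₁
  let w₁ := fibreCoord q₁ v₁
  D2checkLRight Sys 𝒜 q₀ w₀ r₁ ξ₁ - D2checkLRight Sys 𝒜 q₁ w₁ r₂ ξ₁

/-- The intrinsic horizontal equation at the point `(v₀, r₁, v₁, r₂)`: `φ̄` vanishes
on `p₂^*𝒟̂`. -/
def HorizontalEq {Sys : DiscreteSystem EQ Q} (𝒮 : Splitting EG G Sys)
    (𝒜 : LocalDiscreteConnection EQ EG G Q) (v₀ : ConjBundle G Q) (r₁ : OrbitSpace G Q)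
    (v₁ : ConjBundle G Q) (r₂ : OrbitSpace G Q) : Prop :=
  ∀ δr₁ ∈ redDistr EB Sys r₁, barPhi EB 𝒮 𝒜 v₀ r₁ v₁ r₂ δr₁ = 0

/-- The intrinsic vertical equation at the point `(v₀, r₁, v₁, r₂)`: `ψ̄` vanishes
on `(F₁^*𝔤^𝒟)/G`. The fibre of `(F₁^*𝔤^𝒟)/G` over this point consists of the classes of the
`(q₀, w₀, r₁, v₁, r₂, ξ₁)` with `ξ₁ ∈ 𝔤^𝒟_{q₁}`, `q₁ = F̃₁(q₀, w₀, r₁)`, where `(q₀, w₀)` is any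
fixed representative of `v₀`; on it `ψ̄` is given by `ψ̌`. -/
def VerticalEq (Sys : DiscreteSystem EQ Q) (𝒜 : LocalDiscreteConnection EQ EG G Q)
    (v₀ : ConjBundle G Q) (r₁ : OrbitSpace G Q) (v₁ : ConjBundle G Q) (r₂ : OrbitSpace G Q) :
    Prop :=
  ∀ ξ₁ ∈ Sys.lieConstr EG (𝒜.recon v₀.out.1 v₀.out.2 r₁),
    checkPsi Sys 𝒜 v₀.out.1 v₀.out.2 r₁ v₁ r₂ ξ₁ = 0

end Reduced

end DiscreteReduction

end

noncomputable section

namespace DiscreteReduction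

/-! ### The group-theoretic part of the reconstruction -/

section Algebra

variable {G Q : Type*} [Group G] [MulAction G Q]

/-! A curve is a trajectory as soon as it satisfies the kinematic constraints and, at each interior
node, D₁L_d(q₁,q₂)δ + D₂L_d(q₀,q₁)δ = 0 for δ in 𝒟 (`isTrajectory_of_eulerLagrange`). Since 𝒟 = 𝒮 ⊕
ℋ, this is tested on two kinds of vectors.

A vector of 𝒮 is ξ_Q(q₁) with ξ ∈ 𝔤^𝒟. Invariance of L_d turns D₁L_d(q₁,q₂)ξ_Q(q₁) into
-D₂L_d(q₁,q₂)ξ_Q(q₂), and D₂Ľ_d(ξw) is D₂L_d evaluated on the generator at the reconstructed point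
(`D2checkLRight_eq`). What remains is the vertical equation.

On ℋ, the chain rule applied to L_d(q₀,q₁) = Ľ_d(q₀, 𝒜_d(q₀,q₁), π(q₁)) splits each partial
differential of L_d into a partial differential of Ľ_d and a force term (`D1lagr_eq`, `D2lagr_eq`).
Their sum is the horizontal equation.

The rest is equivariance. The reduced equations are read at chosen representatives, which differ
from the reconstructed points by elements of G. Freeness of the action makes fibre coordinates
unique, so that Υ recovers (v_k, r_{k+1}) and the kinematic constraints lift. -/

theorem proj_smul (g : G) (q : Q) : proj G (g • q) = proj G q :=
  Quotient.sound (s := MulAction.orbitRel G Q) ⟨g, rfl⟩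

theorem exists_smul_of_proj_eq {q q' : Q} (h : proj G q = proj G q') : ∃ g : G, g • q' = q :=
  Quotient.exact (s := MulAction.orbitRel G Q) h

theorem rho_smul (g : G) (q : Q) (w : G) : rho (g • q) (g * w * g⁻¹) = rho q w :=
  (Quotient.sound (s := conjSetoid G Q) ⟨g, rfl, rfl⟩ : rho q w = _).symm

theorem exists_of_rho_eq {q q' : Q} {w w' : G} (h : rho q w = rho q' w') :
    ∃ g : G, g • q = q' ∧ g * w * g⁻¹ = w' :=
  Quotient.exact (s := conjSetoid G Q) h

theorem rho_out (v : ConjBundle G Q) : rho v.out.1 v.out.2 = v :=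
  Quotient.out_eq (s := conjSetoid G Q) v

theorem bundleProj_rho (q : Q) (w : G) : bundleProj (rho q w) = proj G q := rfl

theorem tau_smul {q q' : Q} (h : proj G q = proj G q') : (tau q q' : G) • q' = q :=
  Classical.epsilon_spec (p := fun g : G ↦ g • q' = q) (exists_smul_of_proj_eq h)

theorem rho_fibreCoord {q : Q} {v : ConjBundle G Q} (h : bundleProj v = proj G q) :
    rho q (fibreCoord q v) = v := by
  have h' : (tau q v.out.1 : G) • v.out.1 = q :=
    tau_smul (by rw [← h, ← bundleProj_rho v.out.1 v.out.2, rho_out])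
  calc rho q (fibreCoord q v)
      = rho ((tau q v.out.1 : G) • v.out.1) (fibreCoord q v) := by rw [h']
    _ = rho v.out.1 v.out.2 := rho_smul _ _ _
    _ = v := rho_out v

/-- The element relating the two representatives fixes q, hence is 1. Every later identification of
a fibre coordinate rests on this. -/
theorem rho_right_injective (hfree : ∀ (g : G) (q : Q), g • q = q → g = 1) {q : Q} {w w' : G}
    (h : rho q w = rho q w') : w = w' := by
  obtain ⟨g, h₁, h₂⟩ := exists_of_rho_eq h
  simpa [hfree g q h₁] using h₂

end Algebra

/-! ### Equivariance of the discrete connection form and of the reconstruction map -/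

section Form

variable {EQ EG G Q : Type*}
  [NormedAddCommGroup EQ] [NormedSpace ℝ EQ] [NormedAddCommGroup EG] [NormedSpace ℝ EG]
  [Group G] [TopologicalSpace G] [ChartedSpace EG G]
  [TopologicalSpace Q] [ChartedSpace EQ Q] [MulAction G Q]

namespace LocalDiscreteConnection

variable (𝒜 : LocalDiscreteConnection EQ EG G Q)

theorem form_spec {q₀ q₁ : Q} (h : (proj G q₀, proj G q₁) ∈ 𝒜.dom) :
    (q₀, (𝒜.form q₀ q₁)⁻¹ • q₁) ∈ 𝒜.hor ∩ 𝒜.nbhd :=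
  Classical.epsilon_spec (p := fun g : G ↦ (q₀, g⁻¹ • q₁) ∈ 𝒜.hor ∩ 𝒜.nbhd)
    (𝒜.existsUnique q₀ q₁ h).exists

theorem form_eq {q₀ q₁ : Q} (h : (proj G q₀, proj G q₁) ∈ 𝒜.dom) {g : G}
    (hg : (q₀, g⁻¹ • q₁) ∈ 𝒜.hor ∩ 𝒜.nbhd) : 𝒜.form q₀ q₁ = g :=
  (𝒜.existsUnique q₀ q₁ h).unique (𝒜.form_spec h) hg

/-- Any point over π(q₁) is g • q₁, and if it is horizontal then uniqueness in the definition of 𝒜_d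
forces g⁻¹ = 𝒜_d(q₀,q₁). Equivariance and smoothness of the lift are thus inherited from the form.
-/
theorem horLift_proj {q₀ q₁ : Q} (h : (proj G q₀, proj G q₁) ∈ 𝒜.dom) :
    𝒜.horLift q₀ (proj G q₁) = (𝒜.form q₀ q₁)⁻¹ • q₁ := by
  have hspec := @Classical.epsilon_spec Q
    (fun x ↦ (q₀, x) ∈ 𝒜.hor ∩ 𝒜.nbhd ∧ proj G x = proj G q₁)
    ⟨_, 𝒜.form_spec h, proj_smul _ _⟩
  change (q₀, 𝒜.horLift q₀ (proj G q₁)) ∈ _ ∧ proj G (𝒜.horLift q₀ (proj G q₁)) = _ at hspec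
  obtain ⟨hmem, hproj⟩ := hspec
  obtain ⟨g, hg⟩ := exists_smul_of_proj_eq hproj
  rw [← hg] at hmem ⊢
  rw [𝒜.form_eq h (g := g⁻¹) (by simpa using hmem), inv_inv]

theorem recon_form {q₀ q₁ : Q} (h : (proj G q₀, proj G q₁) ∈ 𝒜.dom) :
    𝒜.recon q₀ (𝒜.form q₀ q₁) (proj G q₁) = q₁ := by
  rw [recon, 𝒜.horLift_proj h, smul_inv_smul]

/-- Hor and U are G-invariant, so the translated horizontal pair is again admissible, and uniqueness
identifies the form. -/
theorem form_smul_smul {q₀ q₁ : Q} (h : (proj G q₀, proj G q₁) ∈ 𝒜.dom) (g : G) :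
    𝒜.form (g • q₀) (g • q₁) = g * 𝒜.form q₀ q₁ * g⁻¹ := by
  refine 𝒜.form_eq (by rwa [proj_smul, proj_smul]) ?_
  have : (g * 𝒜.form q₀ q₁ * g⁻¹)⁻¹ • g • q₁ = g • (𝒜.form q₀ q₁)⁻¹ • q₁ := by
    simp only [smul_smul]; congr 1; group
  rw [this]
  exact ⟨𝒜.hor_smul _ _ _ (𝒜.form_spec h).1, 𝒜.nbhd_smul _ _ _ (𝒜.form_spec h).2⟩

theorem horLift_smul {q : Q} {r : OrbitSpace G Q} (h : (proj G q, r) ∈ 𝒜.dom) (g : G) :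
    𝒜.horLift (g • q) r = g • 𝒜.horLift q r := by
  obtain ⟨q₁, rfl⟩ : ∃ q₁, proj G q₁ = r := ⟨r.out, Quotient.out_eq r⟩
  rw [𝒜.horLift_proj h, ← proj_smul g q₁, 𝒜.horLift_proj (by rwa [proj_smul, proj_smul]),
    𝒜.form_smul_smul h]
  simp only [smul_smul]; congr 1; group

theorem proj_recon {q : Q} {w : G} {r : OrbitSpace G Q} (h : (proj G q, r) ∈ 𝒜.dom) :
    proj G (𝒜.recon q w r) = r := by
  obtain ⟨q₁, rfl⟩ : ∃ q₁, proj G q₁ = r := ⟨r.out, Quotient.out_eq r⟩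
  rw [recon, 𝒜.horLift_proj h, proj_smul, proj_smul]

theorem recon_smul {q : Q} {w : G} {r : OrbitSpace G Q} (h : (proj G q, r) ∈ 𝒜.dom) (g : G) :
    𝒜.recon (g • q) (g * w * g⁻¹) r = g • 𝒜.recon q w r := by
  rw [recon, recon, 𝒜.horLift_smul h]
  simp only [smul_smul]; congr 1; group

/-- Both w and the form carry the horizontal lift of r to the same point, so they agree by freeness.
-/
theorem form_recon (hfree : ∀ (g : G) (q : Q), g • q = q → g = 1) {q : Q} {w : G}
    {r : OrbitSpace G Q} (h : (proj G q, r) ∈ 𝒜.dom) : 𝒜.form q (𝒜.recon q w r) = w := by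
  have h' : (proj G q, proj G (𝒜.recon q w r)) ∈ 𝒜.dom := by rwa [𝒜.proj_recon h]
  have e := 𝒜.recon_form h'
  rw [𝒜.proj_recon h, recon, recon, smul_eq_iff_eq_inv_smul, smul_smul] at e
  have := hfree _ _ e.symm
  rw [inv_mul_eq_one] at this
  exact this

/-- A step of the reconstruction from a point of the reduced kinematic constraints. -/
theorem reconstruct_step [IsManifold 𝓘(ℝ, EQ) ∞ Q]
    {Sys : DiscreteSystem EQ Q} (hsymm : Sys.IsSymmetric G)
    {q : Q} {v : ConjBundle G Q} {r : OrbitSpace G Q} (hq : bundleProj v = proj G q)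
    (hkin : (v, r) ∈ redKin Sys 𝒜) :
    (proj G q, r) ∈ 𝒜.dom ∧ (q, 𝒜.recon q (fibreCoord q v) r) ∈ Sys.kin := by
  obtain ⟨⟨a, b⟩, ⟨hab, hdom⟩, he⟩ := hkin
  obtain ⟨hav, rfl⟩ := Prod.ext_iff.1 he
  simp only [upsilon] at hav hdom
  -- The pair (a, b) of 𝒟_d lying over (v, r) is translated so that its first point becomes q; by
  -- equivariance the reconstructed point is then g • b.
  obtain ⟨g, rfl, hg⟩ := exists_of_rho_eq (hav.trans (rho_fibreCoord hq).symm)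
  refine ⟨by rwa [proj_smul], ?_⟩
  rw [upsilon, ← hg, 𝒜.recon_smul hdom, 𝒜.recon_form hdom]
  exact hsymm.kin_smul g a b hab

end LocalDiscreteConnection

end Form

/-! ### Differentials of real functions on manifolds -/

section Calculus

variable {E H M E₁ H₁ M₁ E₂ H₂ M₂ : Type*}
  [NormedAddCommGroup E] [NormedSpace ℝ E] [TopologicalSpace H]
  [TopologicalSpace M] [ChartedSpace H M] {I : ModelWithCorners ℝ E H}
  [NormedAddCommGroup E₁] [NormedSpace ℝ E₁] [TopologicalSpace H₁]
  [TopologicalSpace M₁] [ChartedSpace H₁ M₁] {I₁ : ModelWithCorners ℝ E₁ H₁}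
  [NormedAddCommGroup E₂] [NormedSpace ℝ E₂] [TopologicalSpace H₂]
  [TopologicalSpace M₂] [ChartedSpace H₂ M₂] {I₂ : ModelWithCorners ℝ E₂ H₂}

/-- The differential at `x` of a real function on a manifold. -/
def differential (I : ModelWithCorners ℝ E H) (f : M → ℝ) (x : M) : TangentSpace I x →L[ℝ] ℝ :=
  mfderiv I 𝓘(ℝ, ℝ) f x

theorem differential_comp {f : M₁ → ℝ} {a : M → M₁} {x : M} {y : M₁}
    (hf : MDifferentiableAt I₁ 𝓘(ℝ, ℝ) f y) (ha : MDifferentiableAt I I₁ a x) (hax : a x = y)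
    (v : TangentSpace I x) :
    differential I (fun x ↦ f (a x)) x v = differential I₁ f y (mfderiv I I₁ a x v) :=
  mfderiv_comp_apply_of_eq (x := x) hf ha hax v

theorem differential_comp₂ {F : M₁ → M₂ → ℝ} {a : M → M₁} {b : M → M₂} {x : M} {y₁ : M₁} {y₂ : M₂}
    (hF : MDifferentiableAt (I₁.prod I₂) 𝓘(ℝ, ℝ) (fun p : M₁ × M₂ ↦ F p.1 p.2) (y₁, y₂))
    (ha : MDifferentiableAt I I₁ a x) (hb : MDifferentiableAt I I₂ b x)
    (hax : a x = y₁) (hbx : b x = y₂) (v : TangentSpace I x) :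
    differential I (fun x ↦ F (a x) (b x)) x v =
      differential I₁ (fun y ↦ F y y₂) y₁ (mfderiv I I₁ a x v) +
        differential I₂ (fun y ↦ F y₁ y) y₂ (mfderiv I I₂ b x v) := by
  subst hax hbx
  refine (differential_comp (f := fun p : M₁ × M₂ ↦ F p.1 p.2) (a := fun x ↦ (a x, b x)) hF
    (ha.prodMk hb) rfl v).trans ?_
  rw [MDifferentiableAt.mfderiv_prod ha hb]
  exact mfderiv_prod_eq_add_apply hF

theorem differential_congr {f g : M → ℝ} {x : M} (h : f =ᶠ[𝓝 x] g) :
    differential I f x = differential I g x :=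
  h.mfderiv_eq

end Calculus

/-! ### Principal bundles -/

namespace IsPrincipalBundle

variable {EQ EG EB G Q : Type*}
  [NormedAddCommGroup EQ] [NormedSpace ℝ EQ] [NormedAddCommGroup EG] [NormedSpace ℝ EG]
  [NormedAddCommGroup EB] [NormedSpace ℝ EB]
  [Group G] [TopologicalSpace G] [ChartedSpace EG G]
  [TopologicalSpace Q] [ChartedSpace EQ Q] [MulAction G Q]
  [ChartedSpace EB (OrbitSpace G Q)]

/-- In a trivialization the action is left multiplication on the G factor, which is free. -/
theorem eq_one_of_smul_eq (hb : IsPrincipalBundle EQ EG EB G Q) (g : G) (q : Q) (h : g • q = q) :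
    g = 1 := by
  obtain ⟨O, -, hbO, Φ, hsrc, -, hΦ⟩ := hb.locally_trivial (proj G q)
  have := (hΦ q (by rw [hsrc]; exact hbO)).2 g
  rw [h] at this
  simpa using congrArg Prod.snd this

theorem contMDiff_proj (hb : IsPrincipalBundle EQ EG EB G Q) :
    ContMDiff 𝓘(ℝ, EQ) 𝓘(ℝ, EB) ∞ (proj G : Q → OrbitSpace G Q) := by
  intro q
  obtain ⟨O, -, hbO, Φ, hsrc, -, hΦ⟩ := hb.locally_trivial (proj G q)
  have hq : q ∈ Φ.source := by rw [hsrc]; exact hbO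
  have hnhds := Φ.open_source.mem_nhds hq
  exact ((contMDiff_fst.contMDiffAt.comp q (Φ.contMDiffOn.contMDiffAt hnhds))).congr_of_eventuallyEq
    (by filter_upwards [hnhds] with x hx using (hΦ x hx).1.symm)

theorem mdifferentiableAt_proj (hb : IsPrincipalBundle EQ EG EB G Q) (q : Q) :
    MDifferentiableAt 𝓘(ℝ, EQ) 𝓘(ℝ, EB) (proj G : Q → OrbitSpace G Q) q :=
  hb.contMDiff_proj.contMDiffAt.mdifferentiableAt (by simp)

theorem contMDiff_smul_const (hb : IsPrincipalBundle EQ EG EB G Q) (q : Q) :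
    ContMDiff 𝓘(ℝ, EG) 𝓘(ℝ, EQ) ∞ (fun g : G ↦ g • q) :=
  hb.smooth_smul.comp (contMDiff_id.prodMk contMDiff_const)

theorem mdifferentiableAt_smul_const (hb : IsPrincipalBundle EQ EG EB G Q) (q : Q) (g : G) :
    MDifferentiableAt 𝓘(ℝ, EG) 𝓘(ℝ, EQ) (fun g : G ↦ g • q) g :=
  (hb.contMDiff_smul_const q).contMDiffAt.mdifferentiableAt (by simp)

theorem mdifferentiableAt_const_smul (hb : IsPrincipalBundle EQ EG EB G Q) (g : G) (q : Q) :
    MDifferentiableAt 𝓘(ℝ, EQ) 𝓘(ℝ, EQ) (fun x : Q ↦ g • x) q :=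
  (hb.smooth_smul.comp (contMDiff_const.prodMk contMDiff_id) :
    ContMDiff 𝓘(ℝ, EQ) 𝓘(ℝ, EQ) ∞ (fun x : Q ↦ g • x)).contMDiffAt.mdifferentiableAt (by simp)

/-- Around each point of the base there is a smooth local section of the bundle. -/
theorem exists_section (hb : IsPrincipalBundle EQ EG EB G Q) (r : OrbitSpace G Q) :
    ∃ s : OrbitSpace G Q → Q, ContMDiffAt 𝓘(ℝ, EB) 𝓘(ℝ, EQ) ∞ s r ∧
      ∀ᶠ x in 𝓝 r, proj G (s x) = x := by
  obtain ⟨O, hO, hrO, Φ, hsrc, htgt, hΦ⟩ := hb.locally_trivial r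
  have hmem : ∀ x ∈ O, (x, (1 : G)) ∈ Φ.target := fun x hx ↦ by rw [htgt]; exact ⟨hx, mem_univ _⟩
  refine ⟨fun x ↦ Φ.invFun (x, 1), ?_, ?_⟩
  · exact (Φ.symm.contMDiffOn.contMDiffAt (Φ.open_target.mem_nhds (hmem r hrO))).comp r
      (contMDiff_id.prodMk contMDiff_const).contMDiffAt
  · filter_upwards [hO.mem_nhds hrO] with x hx
    exact (hΦ _ (Φ.map_target (hmem x hx))).1.symm.trans
      (congrArg Prod.fst (Φ.right_inv (hmem x hx)))

/-- The kernel of `dπ` consists of vertical vectors. -/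
theorem mem_vertical [LieGroup 𝓘(ℝ, EG) ∞ G] (hb : IsPrincipalBundle EQ EG EB G Q) {q : Q}
    {v : TangentSpace 𝓘(ℝ, EQ) q}
    (hv : mfderiv 𝓘(ℝ, EQ) 𝓘(ℝ, EB) (proj G : Q → OrbitSpace G Q) q v = 0) :
    v ∈ vertical EQ EG (G := G) q := by
  obtain ⟨O, -, hbO, Φ, hsrc, -, hΦ⟩ := hb.locally_trivial (proj G q)
  have hq : q ∈ Φ.source := by rw [hsrc]; exact hbO
  have hnhds := Φ.open_source.mem_nhds hq
  have hΦd : MDifferentiableAt 𝓘(ℝ, EQ) (𝓘(ℝ, EB).prod 𝓘(ℝ, EG)) Φ q :=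
    Φ.mdifferentiableAt (by simp) hq
  -- It therefore suffices to find ξ whose generator has the same image as v under dΦ.
  have hinj : Function.Injective (mfderiv 𝓘(ℝ, EQ) (𝓘(ℝ, EB).prod 𝓘(ℝ, EG)) Φ q) := by
    have hΨd : MDifferentiableAt (𝓘(ℝ, EB).prod 𝓘(ℝ, EG)) 𝓘(ℝ, EQ) Φ.invFun (Φ q) :=
      Φ.symm.mdifferentiableAt (by simp) (Φ.map_source hq)
    intro x y hxy
    have key : ∀ z, mfderiv (𝓘(ℝ, EB).prod 𝓘(ℝ, EG)) 𝓘(ℝ, EQ) Φ.invFun (Φ q)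
        (mfderiv 𝓘(ℝ, EQ) (𝓘(ℝ, EB).prod 𝓘(ℝ, EG)) Φ q z) = z := by
      intro z
      refine (mfderiv_comp_apply (x := q) hΨd hΦd z).symm.trans ?_
      have : Φ.invFun ∘ Φ =ᶠ[𝓝 q] id := by
        filter_upwards [hnhds] with x hx using Φ.left_inv hx
      erw [this.mfderiv_eq, mfderiv_id]
      rfl
    have := congrArg (mfderiv (𝓘(ℝ, EB).prod 𝓘(ℝ, EG)) 𝓘(ℝ, EQ) Φ.invFun (Φ q)) hxy
    rwa [key, key] at this
  set a : G := (Φ q).2 with ha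
  have hR : ∀ g h : G, MDifferentiableAt 𝓘(ℝ, EG) 𝓘(ℝ, EG) (fun x : G ↦ x * h) g := fun g h ↦
    (contMDiff_mul_right (I := 𝓘(ℝ, EG)) (n := ∞) (a := h)).contMDiffAt.mdifferentiableAt (by simp)
  have hd : ∀ w : TangentSpace 𝓘(ℝ, EQ) q,
      mfderiv 𝓘(ℝ, EQ) (𝓘(ℝ, EB).prod 𝓘(ℝ, EG)) Φ q w =
        (mfderiv 𝓘(ℝ, EQ) 𝓘(ℝ, EB) (proj G : Q → OrbitSpace G Q) q w,
          mfderiv 𝓘(ℝ, EQ) 𝓘(ℝ, EG) (fun x ↦ (Φ x).2) q w) := by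
    intro w
    have hsnd : MDifferentiableAt 𝓘(ℝ, EQ) 𝓘(ℝ, EG) (fun x ↦ (Φ x).2) q :=
      mdifferentiableAt_snd.comp q hΦd
    have : (Φ : Q → OrbitSpace G Q × G) =ᶠ[𝓝 q] fun x ↦ (proj G x, (Φ x).2) := by
      filter_upwards [hnhds] with x hx using Prod.ext (hΦ x hx).1 rfl
    erw [this.mfderiv_eq, MDifferentiableAt.mfderiv_prod (hb.mdifferentiableAt_proj q) hsnd]
    rfl
  set η := mfderiv 𝓘(ℝ, EQ) 𝓘(ℝ, EG) (fun x ↦ (Φ x).2) q v with hη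
  -- Since Φ(g • q) = (π(q), g a), the generator of ξ has image (0, ξa), while v has image (0, η).
  -- So ξ is η translated back to the identity.
  let ξ : GroupLieAlgebra 𝓘(ℝ, EG) G := mfderiv 𝓘(ℝ, EG) 𝓘(ℝ, EG) (fun x : G ↦ x * a⁻¹) a η
  have hξ : mfderiv 𝓘(ℝ, EG) 𝓘(ℝ, EG) (fun x : G ↦ x * a) 1 ξ = η := by
    refine (mfderiv_comp_apply_of_eq (x := a) (hR 1 a) (hR a a⁻¹) (by simp) η).symm.trans ?_
    have : (fun x : G ↦ x * a) ∘ (fun x : G ↦ x * a⁻¹) = id := by ext; simp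
    erw [this, mfderiv_id]
    rfl
  refine ⟨ξ, hinj ?_⟩
  change mfderiv 𝓘(ℝ, EQ) (𝓘(ℝ, EB).prod 𝓘(ℝ, EG)) Φ q
    (mfderiv 𝓘(ℝ, EG) 𝓘(ℝ, EQ) (fun g : G ↦ g • q) 1 ξ) = _
  rw [hd v, hv, ← hη, ← hξ]
  refine (mfderiv_comp_apply_of_eq (x := (1 : G)) hΦd (hb.mdifferentiableAt_smul_const q 1)
    (one_smul G q) ξ).symm.trans ?_
  have : (Φ : Q → OrbitSpace G Q × G) ∘ (fun g : G ↦ g • q) = fun g : G ↦ (proj G q, g * a) := by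
    ext g : 1
    exact (hΦ q hq).2 g
  erw [this, MDifferentiableAt.mfderiv_prod mdifferentiableAt_const (hR 1 a), mfderiv_const]
  rfl

end IsPrincipalBundle

/-! ### Smoothness of the horizontal lift, the reconstruction map and Ľ_d -/

section Smoothness

variable {EQ EG EB G Q : Type*}
  [NormedAddCommGroup EQ] [NormedSpace ℝ EQ] [NormedAddCommGroup EG] [NormedSpace ℝ EG]
  [NormedAddCommGroup EB] [NormedSpace ℝ EB]
  [Group G] [TopologicalSpace G] [ChartedSpace EG G]
  [TopologicalSpace Q] [ChartedSpace EQ Q] [MulAction G Q]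
  [ChartedSpace EB (OrbitSpace G Q)]

namespace LocalDiscreteConnection

variable (𝒜 : LocalDiscreteConnection EQ EG G Q)

theorem contMDiffAt_form (hb : IsPrincipalBundle EQ EG EB G Q) {q₀ q₁ : Q}
    (h : (proj G q₀, proj G q₁) ∈ 𝒜.dom) :
    ContMDiffAt (𝓘(ℝ, EQ).prod 𝓘(ℝ, EQ)) 𝓘(ℝ, EG) ∞ (fun p : Q × Q ↦ 𝒜.form p.1 p.2)
      (q₀, q₁) := by
  refine 𝒜.smooth_form.contMDiffAt ?_
  have hc := hb.contMDiff_proj.continuous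
  exact (𝒜.isOpen_dom.preimage ((hc.comp continuous_fst).prodMk (hc.comp continuous_snd))).mem_nhds h

variable [LieGroup 𝓘(ℝ, EG) ∞ G]

/-- With a local section s of π, the lift is 𝒜_d(q, s(r))⁻¹ • s(r) near the given point, by
`horLift_proj`. Openness of V keeps nearby pairs in the domain. -/
theorem contMDiffAt_horLift (hb : IsPrincipalBundle EQ EG EB G Q) {q : Q} {r : OrbitSpace G Q}
    (h : (proj G q, r) ∈ 𝒜.dom) :
    ContMDiffAt (𝓘(ℝ, EQ).prod 𝓘(ℝ, EB)) 𝓘(ℝ, EQ) ∞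
      (fun p : Q × OrbitSpace G Q ↦ 𝒜.horLift p.1 p.2) (q, r) := by
  obtain ⟨s, hs, hsr⟩ := hb.exists_section r
  have hs' : ContMDiffAt (𝓘(ℝ, EQ).prod 𝓘(ℝ, EB)) 𝓘(ℝ, EQ) ∞
      (fun p : Q × OrbitSpace G Q ↦ s p.2) (q, r) :=
    ContMDiffAt.comp (q, r) (g := s) (f := Prod.snd) hs contMDiff_snd.contMDiffAt
  have hf : ContMDiffAt (𝓘(ℝ, EQ).prod 𝓘(ℝ, EB)) 𝓘(ℝ, EG) ∞
      (fun p : Q × OrbitSpace G Q ↦ 𝒜.form p.1 (s p.2)) (q, r) :=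
    ContMDiffAt.comp (q, r) (g := fun p : Q × Q ↦ 𝒜.form p.1 p.2)
      (f := fun p : Q × OrbitSpace G Q ↦ (p.1, s p.2))
      (𝒜.contMDiffAt_form hb (by rwa [hsr.self_of_nhds])) (contMDiff_fst.contMDiffAt.prodMk hs')
  have hmain : ContMDiffAt (𝓘(ℝ, EQ).prod 𝓘(ℝ, EB)) 𝓘(ℝ, EQ) ∞
      (fun p : Q × OrbitSpace G Q ↦ (𝒜.form p.1 (s p.2))⁻¹ • s p.2) (q, r) :=
    ContMDiffAt.comp (q, r) (g := fun p : G × Q ↦ p.1 • p.2)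
      (f := fun p : Q × OrbitSpace G Q ↦ ((𝒜.form p.1 (s p.2))⁻¹, s p.2))
      hb.smooth_smul.contMDiffAt (hf.inv.prodMk hs')
  refine hmain.congr_of_eventuallyEq ?_
  have hdom : ∀ᶠ p : Q × OrbitSpace G Q in 𝓝 (q, r), (proj G p.1, p.2) ∈ 𝒜.dom :=
    (𝒜.isOpen_dom.preimage
      ((hb.contMDiff_proj.continuous.comp continuous_fst).prodMk continuous_snd)).mem_nhds h
  filter_upwards [hdom, continuous_snd.continuousAt.eventually hsr] with p hp hsp
  conv_lhs => rw [← hsp]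
  exact 𝒜.horLift_proj (by rwa [hsp])

theorem contMDiffAt_recon (hb : IsPrincipalBundle EQ EG EB G Q) {q : Q} (w : G)
    {r : OrbitSpace G Q} (h : (proj G q, r) ∈ 𝒜.dom) :
    ContMDiffAt (𝓘(ℝ, EQ).prod (𝓘(ℝ, EG).prod 𝓘(ℝ, EB))) 𝓘(ℝ, EQ) ∞
      (fun p : Q × G × OrbitSpace G Q ↦ 𝒜.recon p.1 p.2.1 p.2.2) (q, w, r) :=
  ContMDiffAt.comp (q, w, r) (g := fun p : G × Q ↦ p.1 • p.2)
    (f := fun p : Q × G × OrbitSpace G Q ↦ (p.2.1, 𝒜.horLift p.1 p.2.2))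
    hb.smooth_smul.contMDiffAt
    ((contMDiff_fst.comp contMDiff_snd).contMDiffAt.prodMk
      (ContMDiffAt.comp (q, w, r) (g := fun p : Q × OrbitSpace G Q ↦ 𝒜.horLift p.1 p.2)
        (f := fun p : Q × G × OrbitSpace G Q ↦ (p.1, p.2.2)) (𝒜.contMDiffAt_horLift hb h)
        (contMDiff_fst.prodMk (contMDiff_snd.comp contMDiff_snd)).contMDiffAt))

end LocalDiscreteConnection

variable [LieGroup 𝓘(ℝ, EG) ∞ G] [IsManifold 𝓘(ℝ, EQ) ∞ Q] (Sys : DiscreteSystem EQ Q)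
  (𝒜 : LocalDiscreteConnection EQ EG G Q)

theorem mdifferentiableAt_checkL (hb : IsPrincipalBundle EQ EG EB G Q) {q : Q} (w : G)
    {r : OrbitSpace G Q} (h : (proj G q, r) ∈ 𝒜.dom) :
    MDifferentiableAt (𝓘(ℝ, EQ).prod (𝓘(ℝ, EG).prod 𝓘(ℝ, EB))) 𝓘(ℝ, ℝ)
      (fun p : Q × G × OrbitSpace G Q ↦ checkL Sys 𝒜 p.1 p.2.1 p.2.2) (q, w, r) :=
  (ContMDiffAt.comp (q, w, r) (g := Sys.lagr)
    (f := fun p : Q × G × OrbitSpace G Q ↦ (p.1, 𝒜.recon p.1 p.2.1 p.2.2))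
    Sys.smooth_lagr.contMDiffAt
    (contMDiff_fst.contMDiffAt.prodMk (𝒜.contMDiffAt_recon hb w h))).mdifferentiableAt (by simp)

theorem mdifferentiableAt_checkL_left (hb : IsPrincipalBundle EQ EG EB G Q) {q : Q} (w : G)
    {r : OrbitSpace G Q} (h : (proj G q, r) ∈ 𝒜.dom) :
    MDifferentiableAt (𝓘(ℝ, EQ).prod 𝓘(ℝ, EG)) 𝓘(ℝ, ℝ)
      (fun p : Q × G ↦ checkL Sys 𝒜 p.1 p.2 r) (q, w) :=
  MDifferentiableAt.comp (q, w) (f := fun p : Q × G ↦ (p.1, p.2, r))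
    (mdifferentiableAt_checkL Sys 𝒜 hb w h)
    (mdifferentiableAt_fst.prodMk (mdifferentiableAt_snd.prodMk mdifferentiableAt_const))

theorem mdifferentiableAt_checkL_right (hb : IsPrincipalBundle EQ EG EB G Q) {q : Q} (w : G)
    {r : OrbitSpace G Q} (h : (proj G q, r) ∈ 𝒜.dom) :
    MDifferentiableAt (𝓘(ℝ, EG).prod 𝓘(ℝ, EB)) 𝓘(ℝ, ℝ)
      (fun p : G × OrbitSpace G Q ↦ checkL Sys 𝒜 q p.1 p.2) (w, r) :=
  MDifferentiableAt.comp (w, r) (f := fun p : G × OrbitSpace G Q ↦ (q, p.1, p.2))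
    (mdifferentiableAt_checkL Sys 𝒜 hb w h)
    (mdifferentiableAt_const.prodMk (mdifferentiableAt_fst.prodMk mdifferentiableAt_snd))

theorem mdifferentiableAt_checkL_mid (hb : IsPrincipalBundle EQ EG EB G Q) {q : Q} (w : G)
    {r : OrbitSpace G Q} (h : (proj G q, r) ∈ 𝒜.dom) :
    MDifferentiableAt 𝓘(ℝ, EG) 𝓘(ℝ, ℝ) (fun x : G ↦ checkL Sys 𝒜 q x r) w :=
  MDifferentiableAt.comp w (f := fun x : G ↦ (q, x))
    (mdifferentiableAt_checkL_left Sys 𝒜 hb w h)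
    (mdifferentiableAt_const.prodMk mdifferentiableAt_id)

end Smoothness

/-! ### The discrete Euler–Lagrange form of the trajectory condition -/

section EulerLagrange

variable {EQ Q : Type*} [NormedAddCommGroup EQ] [NormedSpace ℝ EQ]
  [TopologicalSpace Q] [ChartedSpace EQ Q]

theorem mfderiv_of_velocity_eq {c : ℝ → Q} {p : Q} {v : TangentSpace 𝓘(ℝ, EQ) p}
    (h : velocity 𝓘(ℝ, EQ) c = ⟨p, v⟩) :
    c 0 = p ∧ (mfderiv 𝓘(ℝ, ℝ) 𝓘(ℝ, EQ) c 0 (1 : ℝ) : EQ) = v := by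
  rw [velocity, Bundle.TotalSpace.mk.injEq] at h
  exact ⟨h.1, eq_of_heq h.2⟩

namespace DiscreteSystem

variable [IsManifold 𝓘(ℝ, EQ) ∞ Q] (Sys : DiscreteSystem EQ Q)

/-- The partial differential `D₁L_d(q₀, q₁)`. -/
def D1lagr (q₀ q₁ : Q) : TangentSpace 𝓘(ℝ, EQ) q₀ →L[ℝ] ℝ :=
  differential 𝓘(ℝ, EQ) (fun q ↦ Sys.lagr (q, q₁)) q₀

/-- The partial differential `D₂L_d(q₀, q₁)`. -/
def D2lagr (q₀ q₁ : Q) : TangentSpace 𝓘(ℝ, EQ) q₁ →L[ℝ] ℝ :=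
  differential 𝓘(ℝ, EQ) (fun q ↦ Sys.lagr (q₀, q)) q₁

theorem mdifferentiableAt_lagr (p : Q × Q) :
    MDifferentiableAt (𝓘(ℝ, EQ).prod 𝓘(ℝ, EQ)) 𝓘(ℝ, ℝ) (fun p : Q × Q ↦ Sys.lagr (p.1, p.2)) p :=
  Sys.smooth_lagr.contMDiffAt.mdifferentiableAt (by simp)

theorem mdifferentiableAt_lagr_left (q₀ q₁ : Q) :
    MDifferentiableAt 𝓘(ℝ, EQ) 𝓘(ℝ, ℝ) (fun q ↦ Sys.lagr (q, q₁)) q₀ :=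
  MDifferentiableAt.comp q₀ (f := fun q : Q ↦ (q, q₁)) (Sys.mdifferentiableAt_lagr (q₀, q₁))
    (mdifferentiableAt_id.prodMk mdifferentiableAt_const)

theorem mdifferentiableAt_lagr_right (q₀ q₁ : Q) :
    MDifferentiableAt 𝓘(ℝ, EQ) 𝓘(ℝ, ℝ) (fun q ↦ Sys.lagr (q₀, q)) q₁ :=
  MDifferentiableAt.comp q₁ (f := fun q : Q ↦ (q₀, q)) (Sys.mdifferentiableAt_lagr (q₀, q₁))
    (mdifferentiableAt_const.prodMk mdifferentiableAt_id)

theorem hasDerivAt_lagr_comp {c₀ c₁ : ℝ → Q} {p₀ p₁ : Q}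
    {v₀ : TangentSpace 𝓘(ℝ, EQ) p₀} {v₁ : TangentSpace 𝓘(ℝ, EQ) p₁}
    (h₀ : MDifferentiableAt 𝓘(ℝ, ℝ) 𝓘(ℝ, EQ) c₀ 0) (h₁ : MDifferentiableAt 𝓘(ℝ, ℝ) 𝓘(ℝ, EQ) c₁ 0)
    (hv₀ : velocity 𝓘(ℝ, EQ) c₀ = ⟨p₀, v₀⟩) (hv₁ : velocity 𝓘(ℝ, EQ) c₁ = ⟨p₁, v₁⟩) :
    HasDerivAt (fun t ↦ Sys.lagr (c₀ t, c₁ t)) (Sys.D1lagr p₀ p₁ v₀ + Sys.D2lagr p₀ p₁ v₁) 0 := by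
  obtain ⟨hp₀, hd₀⟩ := mfderiv_of_velocity_eq hv₀
  obtain ⟨hp₁, hd₁⟩ := mfderiv_of_velocity_eq hv₁
  have hdiff : DifferentiableAt ℝ (fun t ↦ Sys.lagr (c₀ t, c₁ t)) 0 :=
    (MDifferentiableAt.comp (0 : ℝ) (f := fun t : ℝ ↦ (c₀ t, c₁ t))
      (Sys.mdifferentiableAt_lagr (c₀ 0, c₁ 0)) (h₀.prodMk h₁)).differentiableAt
  have hd := differential_comp₂ (I := 𝓘(ℝ, ℝ)) (F := fun x y ↦ Sys.lagr (x, y))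
    (Sys.mdifferentiableAt_lagr (p₀, p₁)) h₀ h₁ hp₀ hp₁ (1 : ℝ)
  rw [differential, mfderiv_eq_fderiv] at hd
  refine hdiff.hasDerivAt.congr_deriv (hd.trans ?_)
  exact congrArg₂ (· + ·) (congrArg (Sys.D1lagr p₀ p₁) hd₀) (congrArg (Sys.D2lagr p₀ p₁) hd₁)

/-- A curve which satisfies the kinematic constraints and the discrete Euler–Lagrange equations
on `𝒟` is a trajectory. -/
theorem isTrajectory_of_eulerLagrange {N : ℕ} (hN : 1 ≤ N) {q : ℕ → Q}
    (hkin : ∀ k < N, (q k, q (k + 1)) ∈ Sys.kin)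
    (hEL : ∀ k, k + 1 < N → ∀ δ ∈ Sys.distr (q (k + 1)),
      Sys.D1lagr (q (k + 1)) (q (k + 2)) δ + Sys.D2lagr (q k) (q (k + 1)) δ = 0) :
    Sys.IsTrajectory N q := by
  refine ⟨hkin, fun δ hδ h0 hδN c hc ↦ ?_⟩
  obtain ⟨M, rfl⟩ : ∃ M, N = M + 1 := ⟨N - 1, by omega⟩
  have hsum : HasDerivAt (fun t ↦ Sys.action (M + 1) fun k ↦ c k t)
      (∑ k ∈ Finset.range (M + 1), (Sys.D1lagr (q k) (q (k + 1)) (δ k) +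
        Sys.D2lagr (q k) (q (k + 1)) (δ (k + 1)))) 0 := by
    refine HasDerivAt.fun_sum fun k hk ↦ ?_
    have hk := Finset.mem_range.1 hk
    exact Sys.hasDerivAt_lagr_comp (hc k (by omega)).1 (hc (k + 1) (by omega)).1
      (hc k (by omega)).2 (hc (k + 1) (by omega)).2
  convert hsum using 1
  -- Discrete integration by parts: the k = 0 term of the D₁ sum and the k = M term of the D₂ sum
  -- vanish with the end variations. The remaining M terms are paired at the interior nodes k + 1.
  rw [Finset.sum_add_distrib, Finset.sum_range_succ', Finset.sum_range_succ _ M, h0, hδN, map_zero,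
    map_zero, add_zero, add_zero, ← Finset.sum_add_distrib]
  refine (Finset.sum_eq_zero fun k hk ↦ ?_).symm
  have hk := Finset.mem_range.1 hk
  exact hEL k (by omega) _ (hδ (k + 1) (by omega))

end DiscreteSystem

end EulerLagrange

/-! ### Consequences of the symmetry and properties of the horizontal lift -/

section Symmetry

variable {EQ EG EB G Q : Type*}
  [NormedAddCommGroup EQ] [NormedSpace ℝ EQ] [NormedAddCommGroup EG] [NormedSpace ℝ EG]
  [NormedAddCommGroup EB] [NormedSpace ℝ EB]
  [Group G] [TopologicalSpace G] [ChartedSpace EG G]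
  [TopologicalSpace Q] [ChartedSpace EQ Q] [IsManifold 𝓘(ℝ, EQ) ∞ Q] [MulAction G Q]
  [ChartedSpace EB (OrbitSpace G Q)]
  {Sys : DiscreteSystem EQ Q}

namespace DiscreteSystem.IsSymmetric

theorem D1lagr_smul (hsymm : Sys.IsSymmetric G) (hb : IsPrincipalBundle EQ EG EB G Q) (g : G)
    (q₀ q₁ : Q) (δ : TangentSpace 𝓘(ℝ, EQ) q₀) :
    Sys.D1lagr (g • q₀) (g • q₁) (mfderiv 𝓘(ℝ, EQ) 𝓘(ℝ, EQ) (fun x : Q ↦ g • x) q₀ δ) =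
      Sys.D1lagr q₀ q₁ δ := by
  refine (differential_comp (Sys.mdifferentiableAt_lagr_left _ _)
    (hb.mdifferentiableAt_const_smul g q₀) rfl δ).symm.trans ?_
  simp only [hsymm.lagr_smul]
  rfl

theorem D2lagr_smul (hsymm : Sys.IsSymmetric G) (hb : IsPrincipalBundle EQ EG EB G Q) (g : G)
    (q₀ q₁ : Q) (δ : TangentSpace 𝓘(ℝ, EQ) q₁) :
    Sys.D2lagr (g • q₀) (g • q₁) (mfderiv 𝓘(ℝ, EQ) 𝓘(ℝ, EQ) (fun x : Q ↦ g • x) q₁ δ) =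
      Sys.D2lagr q₀ q₁ δ := by
  refine (differential_comp (Sys.mdifferentiableAt_lagr_right _ _)
    (hb.mdifferentiableAt_const_smul g q₁) rfl δ).symm.trans ?_
  simp only [hsymm.lagr_smul]
  rfl

/-- Infinitesimal invariance of the lagrangian. -/
theorem D1lagr_infGen (hsymm : Sys.IsSymmetric G) (hb : IsPrincipalBundle EQ EG EB G Q)
    (q₀ q₁ : Q) (ξ : GroupLieAlgebra 𝓘(ℝ, EG) G) :
    Sys.D1lagr q₀ q₁ (infGen EQ EG q₀ ξ) + Sys.D2lagr q₀ q₁ (infGen EQ EG q₁ ξ) = 0 := by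
  have h := differential_comp₂ (I := 𝓘(ℝ, EG)) (F := fun x y ↦ Sys.lagr (x, y))
    (Sys.mdifferentiableAt_lagr (q₀, q₁)) (hb.mdifferentiableAt_smul_const q₀ (1 : G))
    (hb.mdifferentiableAt_smul_const q₁ 1) (one_smul G q₀) (one_smul G q₁) ξ
  have hconst : (fun g : G ↦ Sys.lagr (g • q₀, g • q₁)) = fun _ ↦ Sys.lagr (q₀, q₁) :=
    funext fun g ↦ hsymm.lagr_smul g q₀ q₁
  refine h.symm.trans ((congrArg (fun f ↦ differential 𝓘(ℝ, EG) f 1 ξ) hconst).trans ?_)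
  exact DFunLike.congr_fun mfderiv_const ξ

end DiscreteSystem.IsSymmetric

namespace Splitting

variable (𝒮 : Splitting EG G Sys)

/-- If w + h is vertical with w ∈ 𝒲 and h ∈ ℋ ⊆ 𝒟, then w ∈ 𝒟 + 𝒱, so w = 0. Then h lies in 𝒮 ∩ ℋ =
0. -/
theorem disjoint_horizontal_vertical (q : Q) :
    Disjoint (𝒮.horizontal q) (vertical EQ EG (G := G) q) := by
  rw [Submodule.disjoint_def]
  intro x hx hxV
  obtain ⟨w, hw, h, hh, rfl⟩ := Submodule.mem_sup.1 hx
  have hD : h ∈ Sys.distr q := by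
    rw [← 𝒮.sup_S_H q]; exact Submodule.mem_sup_right hh
  have hw0 : w = 0 := by
    refine Submodule.disjoint_def.1 (𝒮.isCompl_W q).disjoint w hw ?_
    have : w = -h + (w + h) := by abel
    rw [this]
    exact Submodule.add_mem_sup (neg_mem hD) hxV
  subst hw0
  rw [zero_add] at hxV ⊢
  exact Submodule.disjoint_def.1 (𝒮.disjoint_S_H q) h ⟨hxV, hD⟩ hh

theorem smul_mem_horizontal (g : G) {q : Q} {x : TangentSpace 𝓘(ℝ, EQ) q}
    (hx : x ∈ 𝒮.horizontal q) :
    mfderiv 𝓘(ℝ, EQ) 𝓘(ℝ, EQ) (fun x : Q ↦ g • x) q x ∈ 𝒮.horizontal (g • q) := by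
  obtain ⟨w, hw, h, hh, rfl⟩ := Submodule.mem_sup.1 hx
  rw [map_add]
  exact Submodule.add_mem_sup (𝒮.invariant_W g q w hw) (𝒮.invariant_H g q h hh)

variable [LieGroup 𝓘(ℝ, EG) ∞ G]

/-- Two horizontal vectors with the same projection differ by a vector that is both horizontal and
vertical. This determines the chosen value of `lift`. -/
theorem lift_eq (hb : IsPrincipalBundle EQ EG EB G Q) {q : Q} {r : OrbitSpace G Q}
    {δr : TangentSpace 𝓘(ℝ, EB) r} {x : TangentSpace 𝓘(ℝ, EQ) q} (hx : x ∈ 𝒮.horizontal q)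
    (hxr : tangentMap 𝓘(ℝ, EQ) 𝓘(ℝ, EB) (proj G) ⟨q, x⟩ = ⟨r, δr⟩) : 𝒮.lift EB q δr = x := by
  have hs : 𝒮.lift EB q δr ∈ 𝒮.horizontal q ∧
      tangentMap 𝓘(ℝ, EQ) 𝓘(ℝ, EB) (proj G) ⟨q, 𝒮.lift EB q δr⟩ = ⟨r, δr⟩ :=
    Classical.epsilon_spec (p := fun v : TangentSpace 𝓘(ℝ, EQ) q ↦ v ∈ 𝒮.horizontal q ∧
      tangentMap 𝓘(ℝ, EQ) 𝓘(ℝ, EB) (proj G) ⟨q, v⟩ = ⟨r, δr⟩) ⟨x, hx, hxr⟩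
  have heq := hs.2.trans hxr.symm
  simp only [tangentMap, Bundle.TotalSpace.mk.injEq, heq_eq_eq, true_and] at heq
  rw [← sub_eq_zero]
  exact Submodule.disjoint_def.1 (𝒮.disjoint_horizontal_vertical q) _ (sub_mem hs.1 hx)
    (hb.mem_vertical (by rw [map_sub, heq, sub_self]))

theorem lift_mfderiv_proj (hb : IsPrincipalBundle EQ EG EB G Q) {q : Q}
    {x : TangentSpace 𝓘(ℝ, EQ) q} (hx : x ∈ 𝒮.horizontal q) :
    𝒮.lift EB q (mfderiv 𝓘(ℝ, EQ) 𝓘(ℝ, EB) (proj G : Q → OrbitSpace G Q) q x) = x :=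
  𝒮.lift_eq hb hx rfl

theorem lift_smul (hb : IsPrincipalBundle EQ EG EB G Q) (g : G) {q : Q}
    {x : TangentSpace 𝓘(ℝ, EQ) q} (hx : x ∈ 𝒮.horizontal q) :
    𝒮.lift EB (g • q) (mfderiv 𝓘(ℝ, EQ) 𝓘(ℝ, EB) (proj G : Q → OrbitSpace G Q) q x) =
      mfderiv 𝓘(ℝ, EQ) 𝓘(ℝ, EQ) (fun x : Q ↦ g • x) q x := by
  refine 𝒮.lift_eq hb (𝒮.smul_mem_horizontal g hx) ?_
  refine (tangentMap_comp_at (I := 𝓘(ℝ, EQ)) (I' := 𝓘(ℝ, EQ)) (I'' := 𝓘(ℝ, EB))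
    (f := fun x : Q ↦ g • x) (g := proj G) ⟨q, x⟩
    (hb.mdifferentiableAt_proj _) (hb.mdifferentiableAt_const_smul g q)).symm.trans ?_
  have : (proj G ∘ fun x : Q ↦ g • x) = (proj G : Q → OrbitSpace G Q) :=
    funext fun x ↦ proj_smul g x
  rw [this]
  rfl

end Splitting

end Symmetry

/-! ### Reduced and unreduced equations of motion -/

section Equations

variable {EQ EG EB G Q : Type*}
  [NormedAddCommGroup EQ] [NormedSpace ℝ EQ] [NormedAddCommGroup EG] [NormedSpace ℝ EG]
  [NormedAddCommGroup EB] [NormedSpace ℝ EB]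
  [Group G] [TopologicalSpace G] [ChartedSpace EG G]
  [TopologicalSpace Q] [ChartedSpace EQ Q] [MulAction G Q]
  [ChartedSpace EB (OrbitSpace G Q)]
  (𝒜 : LocalDiscreteConnection EQ EG G Q)

namespace LocalDiscreteConnection

theorem mdifferentiableAt_form_left (hb : IsPrincipalBundle EQ EG EB G Q) {q₀ q₁ : Q}
    (h : (proj G q₀, proj G q₁) ∈ 𝒜.dom) :
    MDifferentiableAt 𝓘(ℝ, EQ) 𝓘(ℝ, EG) (fun q ↦ 𝒜.form q q₁) q₀ :=
  MDifferentiableAt.comp q₀ (g := fun p : Q × Q ↦ 𝒜.form p.1 p.2) (f := fun q : Q ↦ (q, q₁))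
    ((𝒜.contMDiffAt_form hb h).mdifferentiableAt (by simp))
    (mdifferentiableAt_id.prodMk mdifferentiableAt_const)

theorem mdifferentiableAt_form_right (hb : IsPrincipalBundle EQ EG EB G Q) {q₀ q₁ : Q}
    (h : (proj G q₀, proj G q₁) ∈ 𝒜.dom) :
    MDifferentiableAt 𝓘(ℝ, EQ) 𝓘(ℝ, EG) (fun q ↦ 𝒜.form q₀ q) q₁ :=
  MDifferentiableAt.comp q₁ (g := fun p : Q × Q ↦ 𝒜.form p.1 p.2) (f := fun q : Q ↦ (q₀, q))
    ((𝒜.contMDiffAt_form hb h).mdifferentiableAt (by simp))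
    (mdifferentiableAt_const.prodMk mdifferentiableAt_id)

theorem eventually_mem_dom_left (hb : IsPrincipalBundle EQ EG EB G Q) {q : Q} {r : OrbitSpace G Q}
    (h : (proj G q, r) ∈ 𝒜.dom) : ∀ᶠ x in 𝓝 q, (proj G x, r) ∈ 𝒜.dom :=
  (𝒜.isOpen_dom.preimage (hb.contMDiff_proj.continuous.prodMk continuous_const)).mem_nhds h

theorem eventually_mem_dom_right (hb : IsPrincipalBundle EQ EG EB G Q) {q : Q} {r : OrbitSpace G Q}
    (h : (r, proj G q) ∈ 𝒜.dom) : ∀ᶠ x in 𝓝 q, (r, proj G x) ∈ 𝒜.dom :=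
  (𝒜.isOpen_dom.preimage (continuous_const.prodMk hb.contMDiff_proj.continuous)).mem_nhds h

end LocalDiscreteConnection

variable [IsManifold 𝓘(ℝ, EQ) ∞ Q] {Sys : DiscreteSystem EQ Q}

theorem checkL_smul (hsymm : Sys.IsSymmetric G) {q : Q} {w : G} {r : OrbitSpace G Q}
    (h : (proj G q, r) ∈ 𝒜.dom) (g : G) :
    checkL Sys 𝒜 (g • q) (g * w * g⁻¹) r = checkL Sys 𝒜 q w r := by
  rw [checkL, 𝒜.recon_smul h, hsymm.lagr_smul, checkL]

theorem checkL_form {q₀ q₁ : Q} (h : (proj G q₀, proj G q₁) ∈ 𝒜.dom) :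
    checkL Sys 𝒜 q₀ (𝒜.form q₀ q₁) (proj G q₁) = Sys.lagr (q₀, q₁) := by
  rw [checkL, 𝒜.recon_form h]

variable [LieGroup 𝓘(ℝ, EG) ∞ G]

/-- The chain rule for q ↦ Ľ_d(q, 𝒜_d(q, q₁), π(q₁)), which equals L_d(q, q₁) for q near q₀ because
V is open. -/
theorem D1lagr_eq (hb : IsPrincipalBundle EQ EG EB G Q) {q₀ q₁ : Q} {w : G}
    (h : (proj G q₀, proj G q₁) ∈ 𝒜.dom) (hw : 𝒜.form q₀ q₁ = w) (x : TangentSpace 𝓘(ℝ, EQ) q₀) :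
    Sys.D1lagr q₀ q₁ x = D1checkL Sys 𝒜 q₀ w (proj G q₁) x +
      D2checkL Sys 𝒜 q₀ w (proj G q₁) (D1form 𝒜 q₀ q₁ x) := by
  have hc := differential_comp₂ (I := 𝓘(ℝ, EQ)) (a := id) (b := fun q ↦ 𝒜.form q q₁)
    (F := fun q w ↦ checkL Sys 𝒜 q w (proj G q₁)) (mdifferentiableAt_checkL_left Sys 𝒜 hb w h)
    mdifferentiableAt_id (𝒜.mdifferentiableAt_form_left hb h) rfl hw x
  rw [mfderiv_id] at hc
  refine Eq.trans ?_ hc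
  refine DFunLike.congr_fun (differential_congr ?_) x
  filter_upwards [𝒜.eventually_mem_dom_left hb h] with q hq using (checkL_form 𝒜 hq).symm

theorem D2lagr_eq (hb : IsPrincipalBundle EQ EG EB G Q) {q₀ q₁ : Q} {w : G}
    (h : (proj G q₀, proj G q₁) ∈ 𝒜.dom) (hw : 𝒜.form q₀ q₁ = w) (x : TangentSpace 𝓘(ℝ, EQ) q₁) :
    Sys.D2lagr q₀ q₁ x = D2checkL Sys 𝒜 q₀ w (proj G q₁) (D2form 𝒜 q₀ q₁ x) +
      D3checkL EB Sys 𝒜 q₀ w (proj G q₁) (mfderiv 𝓘(ℝ, EQ) 𝓘(ℝ, EB) (proj G) q₁ x) := by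
  have hc := differential_comp₂ (I := 𝓘(ℝ, EQ)) (a := fun q ↦ 𝒜.form q₀ q) (b := proj G)
    (F := fun w r ↦ checkL Sys 𝒜 q₀ w r) (mdifferentiableAt_checkL_right Sys 𝒜 hb w h)
    (𝒜.mdifferentiableAt_form_right hb h) (hb.mdifferentiableAt_proj q₁) hw rfl x
  refine Eq.trans ?_ hc
  refine DFunLike.congr_fun (differential_congr ?_) x
  filter_upwards [𝒜.eventually_mem_dom_right hb h] with q hq using (checkL_form 𝒜 hq).symm

/-- Replacing w by gw replaces the reconstructed point w • h by g • (w • h); both sides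
differentiate the same function of g at 1. -/
theorem D2checkLRight_eq (hb : IsPrincipalBundle EQ EG EB G Q) {q : Q} {w : G}
    {r : OrbitSpace G Q} (h : (proj G q, r) ∈ 𝒜.dom) (ξ : GroupLieAlgebra 𝓘(ℝ, EG) G) :
    D2checkLRight Sys 𝒜 q w r ξ =
      Sys.D2lagr q (𝒜.recon q w r) (infGen EQ EG (𝒜.recon q w r) ξ) := by
  have h₁ := differential_comp (I := 𝓘(ℝ, EG)) (a := fun g : G ↦ g * w) (x := 1)
    (mdifferentiableAt_checkL_mid Sys 𝒜 hb w h)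
    ((contMDiff_mul_right (I := 𝓘(ℝ, EG)) (n := ∞) (a := w)).contMDiffAt.mdifferentiableAt
      (by simp)) (one_mul w) ξ
  have h₂ := differential_comp (I := 𝓘(ℝ, EG))
    (Sys.mdifferentiableAt_lagr_right q (𝒜.recon q w r))
    (hb.mdifferentiableAt_smul_const (𝒜.recon q w r) (1 : G)) (one_smul G _) ξ
  refine h₁.symm.trans (Eq.trans ?_ h₂)
  simp only [checkL, LocalDiscreteConnection.recon, mul_smul]

/-- The reduced force `F̂_d⁻` may be computed at any representative. -/
theorem forceMinus_eq (hb : IsPrincipalBundle EQ EG EB G Q) (hsymm : Sys.IsSymmetric G)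
    (𝒮 : Splitting EG G Sys) {v : ConjBundle G Q} {q₀ q₁ : Q} {w : G}
    (hv : rho q₀ w = v) (h : (proj G q₀, proj G q₁) ∈ 𝒜.dom) (hw : 𝒜.form q₀ q₁ = w)
    {x : TangentSpace 𝓘(ℝ, EQ) q₀} (hx : x ∈ 𝒮.horizontal q₀) :
    forceMinus EB 𝒮 𝒜 v (proj G q₁) (mfderiv 𝓘(ℝ, EQ) 𝓘(ℝ, EB) (proj G : Q → OrbitSpace G Q) q₀ x) =
      D2checkL Sys 𝒜 q₀ w (proj G q₁) (D1form 𝒜 q₀ q₁ x) := by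
  obtain ⟨g, h₁, h₂⟩ := exists_of_rho_eq (hv.trans (rho_out v).symm)
  have hrec : 𝒜.recon v.out.1 v.out.2 (proj G q₁) = g • q₁ := by
    rw [← h₁, ← h₂, 𝒜.recon_smul h, ← hw, 𝒜.recon_form h]
  simp only [forceMinus]
  rw [hrec, ← h₁, ← h₂, 𝒮.lift_smul hb g hx]
  have hg : (proj G (g • q₀), proj G (g • q₁)) ∈ 𝒜.dom := by rwa [proj_smul, proj_smul]
  have hg' : (proj G (g • q₀), proj G q₁) ∈ 𝒜.dom := by rwa [proj_smul]
  have hd := 𝒜.mdifferentiableAt_form_left hb hg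
  have e₁ := differential_comp (I := 𝓘(ℝ, EQ)) (a := fun q ↦ 𝒜.form q (g • q₁))
    (mdifferentiableAt_checkL_mid Sys 𝒜 hb (g * w * g⁻¹) hg') hd
    (by rw [𝒜.form_smul_smul h, hw])
    (mfderiv 𝓘(ℝ, EQ) 𝓘(ℝ, EQ) (fun x : Q ↦ g • x) q₀ x)
  have e₂ := differential_comp (I := 𝓘(ℝ, EQ)) (a := fun x : Q ↦ g • x)
    (f := fun y ↦ checkL Sys 𝒜 (g • q₀) (𝒜.form y (g • q₁)) (proj G q₁))
    (MDifferentiableAt.comp (g • q₀) (g := fun w ↦ checkL Sys 𝒜 (g • q₀) w (proj G q₁))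
      (mdifferentiableAt_checkL_mid Sys 𝒜 hb _ hg') hd)
    (hb.mdifferentiableAt_const_smul g q₀) rfl x
  have e₃ := differential_comp (I := 𝓘(ℝ, EQ)) (a := fun q ↦ 𝒜.form q q₁)
    (mdifferentiableAt_checkL_mid Sys 𝒜 hb w h) (𝒜.mdifferentiableAt_form_left hb h) hw x
  -- Both sides are differentials at q₀, with the first slot of Ľ_d frozen: of q ↦ Ľ_d(g • q₀, 𝒜_d(g
  -- • q, g • q₁), π(q₁)) and of q ↦ Ľ_d(q₀, 𝒜_d(q, q₁), π(q₁)). These agree near q₀ by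
  -- equivariance.
  refine e₁.symm.trans (e₂.symm.trans (Eq.trans ?_ e₃))
  refine DFunLike.congr_fun (differential_congr ?_) x
  filter_upwards [𝒜.eventually_mem_dom_left hb h] with q hq
  rw [𝒜.form_smul_smul hq, checkL_smul 𝒜 hsymm h]

/-- The reduced equations at `(v₀, r₁, v₁, r₂)` imply the discrete Euler–Lagrange equations at the
points reconstructed from the representative of `v₀`. -/
theorem eulerLagrange_of_reduced (hb : IsPrincipalBundle EQ EG EB G Q) (hsymm : Sys.IsSymmetric G)
    (𝒮 : Splitting EG G Sys) {v₀ v₁ : ConjBundle G Q} {q₁ : Q} {r₁ r₂ : OrbitSpace G Q}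
    (hq₁ : 𝒜.recon v₀.out.1 v₀.out.2 r₁ = q₁) (h₀₁ : (proj G v₀.out.1, r₁) ∈ 𝒜.dom)
    (hv₁ : bundleProj v₁ = r₁) (h₁₂ : (r₁, r₂) ∈ 𝒜.dom)
    (hhor : HorizontalEq EB 𝒮 𝒜 v₀ r₁ v₁ r₂) (hvert : VerticalEq Sys 𝒜 v₀ r₁ v₁ r₂)
    {δ : TangentSpace 𝓘(ℝ, EQ) q₁} (hδ : δ ∈ Sys.distr q₁) :
    Sys.D1lagr q₁ (𝒜.recon q₁ (fibreCoord q₁ v₁) r₂) δ + Sys.D2lagr v₀.out.1 q₁ δ = 0 := by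
  obtain rfl : proj G q₁ = r₁ := by rw [← hq₁, 𝒜.proj_recon h₀₁]
  set w₁ := fibreCoord q₁ v₁ with hw₁
  have hρ : rho q₁ w₁ = v₁ := rho_fibreCoord hv₁
  have hform₀ : 𝒜.form v₀.out.1 q₁ = v₀.out.2 := by
    conv_lhs => rw [← hq₁]
    exact 𝒜.form_recon hb.eq_one_of_smul_eq h₀₁
  obtain ⟨q₂, hq₂⟩ : ∃ q₂, 𝒜.recon q₁ w₁ r₂ = q₂ := ⟨_, rfl⟩
  obtain rfl : proj G q₂ = r₂ := by rw [← hq₂, 𝒜.proj_recon h₁₂]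
  have hform₁ : 𝒜.form q₁ q₂ = w₁ := by
    conv_lhs => rw [← hq₂]
    exact 𝒜.form_recon hb.eq_one_of_smul_eq h₁₂
  rw [hq₂]
  rw [← 𝒮.sup_S_H q₁] at hδ
  obtain ⟨s, hs, x, hx, rfl⟩ := Submodule.mem_sup.1 hδ
  have hS : Sys.D1lagr q₁ q₂ s + Sys.D2lagr v₀.out.1 q₁ s = 0 := by
    obtain ⟨⟨ξ, rfl⟩, hsD⟩ := hs
    have e := hvert ξ (by rw [hq₁]; exact hsD)
    simp only [checkPsi] at e
    rw [D2checkLRight_eq 𝒜 hb h₀₁, hq₁, ← hw₁, D2checkLRight_eq 𝒜 hb h₁₂, hq₂] at e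
    -- The vertical equation now equates D₂L_d(q₀,q₁)ξ_Q(q₁) with D₂L_d(q₁,q₂)ξ_Q(q₂); infinitesimal
    -- invariance replaces the latter by -D₁L_d(q₁,q₂)ξ_Q(q₁).
    have e' := hsymm.D1lagr_infGen hb q₁ q₂ ξ
    change Sys.D1lagr q₁ q₂ (infGen EQ EG q₁ ξ) + Sys.D2lagr v₀.out.1 q₁ (infGen EQ EG q₁ ξ) = 0
    linarith
  have hH : Sys.D1lagr q₁ q₂ x + Sys.D2lagr v₀.out.1 q₁ x = 0 := by
    have hxh : x ∈ 𝒮.horizontal q₁ := Submodule.mem_sup_right hx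
    have hxD : x ∈ Sys.distr q₁ := by rw [← 𝒮.sup_S_H q₁]; exact Submodule.mem_sup_right hx
    have e := hhor (mfderiv 𝓘(ℝ, EQ) 𝓘(ℝ, EB) (proj G : Q → OrbitSpace G Q) q₁ x) ⟨q₁, x, hxD, rfl⟩
    simp only [barPhi, checkPhi, forcePlus] at e
    -- The force F̂⁺ at v₀ already uses the representative of v₀ at hand. Only F̂⁻ at v₁ must be
    -- moved, from the chosen representative of v₁ to (q₁, w₁).
    rw [rho_out, hq₁, ← hw₁, 𝒮.lift_mfderiv_proj hb hxh,
      forceMinus_eq 𝒜 hb hsymm 𝒮 hρ h₁₂ hform₁ hxh] at e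
    rw [D1lagr_eq 𝒜 hb h₁₂ hform₁, D2lagr_eq 𝒜 hb h₀₁ hform₀]
    linarith
  rw [map_add, map_add]
  linarith

end Equations

end DiscreteReduction

end

/-! ### The reconstruction theorem -/

theorem mainTheorem3
    {EQ EG EB G Q : Type*}
    [NormedAddCommGroup EQ] [NormedSpace ℝ EQ] [FiniteDimensional ℝ EQ]
    [NormedAddCommGroup EG] [NormedSpace ℝ EG] [FiniteDimensional ℝ EG]
    [NormedAddCommGroup EB] [NormedSpace ℝ EB] [FiniteDimensional ℝ EB]
    [Group G] [TopologicalSpace G] [ChartedSpace EG G] [LieGroup 𝓘(ℝ, EG) ∞ G]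
    [TopologicalSpace Q] [ChartedSpace EQ Q] [IsManifold 𝓘(ℝ, EQ) ∞ Q] [MulAction G Q]
    [ChartedSpace EB (DiscreteReduction.OrbitSpace G Q)]
    [IsManifold 𝓘(ℝ, EB) ∞ (DiscreteReduction.OrbitSpace G Q)]
    (hbundle : DiscreteReduction.IsPrincipalBundle EQ EG EB G Q)
    (Sys : DiscreteReduction.DiscreteSystem EQ Q) (hsymm : Sys.IsSymmetric G)
    (𝒮 : DiscreteReduction.Splitting EG G Sys)
    (𝒜 : DiscreteReduction.LocalDiscreteConnection EQ EG G Q)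
    (N : ℕ) (hN : 1 ≤ N)
    (qbar₀ qbar₁ : Q) (hqbar : (qbar₀, qbar₁) ∈ Sys.kin)
    (v : ℕ → DiscreteReduction.ConjBundle G Q) (r : ℕ → DiscreteReduction.OrbitSpace G Q)
    (hv : ∀ k < N, DiscreteReduction.bundleProj (v k) = r k)
    (hr₀ : DiscreteReduction.proj G qbar₀ = r 0) (hr₁ : DiscreteReduction.proj G qbar₁ = r 1)
    (hv₀ : v 0 = DiscreteReduction.rho qbar₀ (𝒜.form qbar₀ qbar₁))
    (hkin : ∀ k < N, (v k, r (k + 1)) ∈ DiscreteReduction.redKin Sys 𝒜)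
    (hhor : ∀ k, k + 1 < N →
      DiscreteReduction.HorizontalEq EB 𝒮 𝒜 (v k) (r (k + 1)) (v (k + 1)) (r (k + 2)))
    (hvert : ∀ k, k + 1 < N →
      DiscreteReduction.VerticalEq Sys 𝒜 (v k) (r (k + 1)) (v (k + 1)) (r (k + 2))) :
    Sys.IsTrajectory N (𝒜.reconstruct v r qbar₀) ∧
    (∀ k ≤ N, DiscreteReduction.proj G (𝒜.reconstruct v r qbar₀ k) = r k) ∧
    (∀ k < N, (r k, r (k + 1)) ∈ 𝒜.dom ∧
      𝒜.upsilon (𝒜.reconstruct v r qbar₀ k, 𝒜.reconstruct v r qbar₀ (k + 1)) =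
        (v k, r (k + 1))) ∧
    𝒜.reconstruct v r qbar₀ 0 = qbar₀ ∧ 𝒜.reconstruct v r qbar₀ 1 = qbar₁ := by
  open DiscreteReduction in
  set q := 𝒜.reconstruct v r qbar₀
  have hstep : ∀ k, q (k + 1) = 𝒜.recon (q k) (fibreCoord (q k) (v k)) (r (k + 1)) := fun _ ↦ rfl
  -- Knowing that q k lies over r k places v k over q k; membership in the reduced constraints then
  -- gives the domain condition that makes the next point lie over r (k + 1).
  have hproj : ∀ k ≤ N, proj G (q k) = r k := by
    intro k
    induction k with
    | zero => exact fun _ ↦ hr₀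
    | succ k ih =>
      intro hk
      have ih := ih (by omega)
      rw [hstep, 𝒜.proj_recon
        (𝒜.reconstruct_step hsymm ((hv k hk).trans ih.symm) (hkin k hk)).1]
  have hv' : ∀ k < N, bundleProj (v k) = proj G (q k) := fun k hk ↦
    (hv k hk).trans (hproj k hk.le).symm
  have hdom : ∀ k < N, (proj G (q k), r (k + 1)) ∈ 𝒜.dom := fun k hk ↦
    (𝒜.reconstruct_step hsymm (hv' k hk) (hkin k hk)).1
  have hform : ∀ k < N, 𝒜.form (q k) (q (k + 1)) = fibreCoord (q k) (v k) := fun k hk ↦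
    𝒜.form_recon hbundle.eq_one_of_smul_eq (hdom k hk)
  refine ⟨Sys.isTrajectory_of_eulerLagrange hN
    (fun k hk ↦ (𝒜.reconstruct_step hsymm (hv' k hk) (hkin k hk)).2) ?_, hproj,
    fun k hk ↦ ⟨hproj k hk.le ▸ hdom k hk, ?_⟩, rfl, ?_⟩
  · intro k hk δ hδ
    have hk' : k < N := by omega
    -- The reduced equations are read at the chosen representative of v k, a translate by g of (q k,
    -- u_k). The Euler–Lagrange equation is obtained for the translated points and carried back by
    -- invariance of L_d and 𝒟.
    obtain ⟨g, h₁, h₂⟩ := exists_of_rho_eq ((rho_fibreCoord (hv' k hk')).trans (rho_out (v k)).symm)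
    have hq₁ : 𝒜.recon (v k).out.1 (v k).out.2 (r (k + 1)) = g • q (k + 1) := by
      rw [← h₁, ← h₂, 𝒜.recon_smul (hdom k hk'), hstep]
    have hq₂ : 𝒜.recon (g • q (k + 1)) (fibreCoord (g • q (k + 1)) (v (k + 1))) (r (k + 2)) =
        g • q (k + 2) := by
      have hc : fibreCoord (g • q (k + 1)) (v (k + 1)) =
          g * fibreCoord (q (k + 1)) (v (k + 1)) * g⁻¹ := by
        refine rho_right_injective hbundle.eq_one_of_smul_eq (q := g • q (k + 1)) ?_
        rw [rho_smul, rho_fibreCoord (hv' _ hk), rho_fibreCoord (by rw [hv' _ hk, proj_smul])]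
      rw [hc, 𝒜.recon_smul (hdom _ hk), hstep (k + 1)]
    have e := eulerLagrange_of_reduced 𝒜 hbundle hsymm 𝒮 hq₁
      (by rw [← h₁, proj_smul]; exact hdom k hk') (hv _ hk) (hproj _ hk.le ▸ hdom _ hk)
      (hhor k hk) (hvert k hk) (hsymm.distr_smul g _ δ hδ)
    rwa [hq₂, ← h₁, hsymm.D1lagr_smul hbundle, hsymm.D2lagr_smul hbundle] at e
  · rw [LocalDiscreteConnection.upsilon]
    exact Prod.ext ((congrArg _ (hform k hk)).trans (rho_fibreCoord (hv' k hk))) (hproj _ hk)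
  -- The initial condition on v 0 fixes the first fibre coordinate, so the first step inverts the
  -- form and returns the prescribed second point.
  · have hc : fibreCoord qbar₀ (v 0) = 𝒜.form qbar₀ qbar₁ := by
      refine rho_right_injective hbundle.eq_one_of_smul_eq (q := qbar₀) ?_
      exact (rho_fibreCoord (hv' 0 hN)).trans hv₀
    change 𝒜.recon qbar₀ (fibreCoord qbar₀ (v 0)) (r 1) = qbar₁
    rw [hc, ← hr₁, 𝒜.recon_form (by rw [hr₁]; exact hdom 0 hN)]
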